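/- Let $\mathsf G$ be a Hausdorff, unimodular, locally compact group with Haar measure $dx$, and let $\mathscr C=\bigsqcup_{x\in\mathsf G}\mathfrak C_x$ be a Fell bundle over $\mathsf G$ with multiplication $\bullet$ and involution ${}^\bullet$. Let $\nu:\mathsf G\to[1,\infty)$ be a polynomial weight, that is, a measurable, locally bounded function with $\nu(xy)\le\nu(x)\nu(y)$ and $\nu(x^{-1})=\nu(x)$ for all $x,y\in\mathsf G$, for which there is a constant $C>0$ such that $\nu(xy)\le C(\nu(x)+\nu(y))$ for all $x,y\in\mathsf G$. Let $L^{1,\nu}(\mathsf G\,|\,\mathscr C)$ be the Banach $^*$-algebra obtained by completing the space $C_{\rm c}(\mathsf G\,|\,\mathscr C)$ of continuous cross-sections with compact support in the norm $\|\Phi\|_{1,\nu}=\int_{\mathsf G}\nu(x)\|\Phi(x)\|_{\mathfrak C_x}\,dx$, with product $(\Phi*\Psi)(x)=\int_{\mathsf G}\Phi(y)\bullet\Psi(y^{-1}x)\,dy$ and involution $\Phi^*(x)=\Phi(x^{-1})^\bullet$, and let $L^1(\mathsf G\,|\,\mathscr C)$ be the algebra obtained in this way for the constant weight $1$. Then: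 1. The identity of $C_{\rm c}(\mathsf G\,|\,\mathscr C)$ extends to a continuous injective $^*$-homomorphism $L^{1,\nu}(\mathsf G\,|\,\mathscr C)\hookrightarrow L^1(\mathsf G\,|\,\mathscr C)$, and $L^{1,\nu}(\mathsf G\,|\,\mathscr C)$ is inverse-closed in $L^1(\mathsf G\,|\,\mathscr C)$: for every $\Phi\in L^{1,\nu}(\mathsf G\,|\,\mathscr C)$, ${\rm Spec}_{L^{1,\nu}(\mathsf G|\mathscr C)}(\Phi)={\rm Spec}_{L^{1}(\mathsf G|\mathscr C)}(\Phi)$. Here ${\rm Spec}_{\mathfrak B}(b)$ is the set of $\lambda\in\mathbb C$ such that $b-\lambda 1$ is not invertible in the minimal unitization of $\mathfrak B$, which is $\mathfrak B$ itself if $\mathfrak B$ is unital and $\mathfrak B\oplus\mathbb C$ otherwise. 2. For every $C^*$-algebra $\mathfrak B$, every $^*$-homomorphism $\varphi:L^{1,\nu}(\mathsf G\,|\,\mathscr C)\to\mathfrak B$ (not assumed continuous) extends to a $^*$-homomorphism $L^1(\mathsf G\,|\,\mathscr C)\to\mathfrak B$. -/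

import Mathlib

set_option linter.unusedSectionVars false

open MeasureTheory Filter Topology

universe u v w

/-- A Fell bundle (`C*`-algebraic bundle) over the topological group `G`.  A fibre
multiplication `C_x × C_y → C_{xy}` and an involution `C_x → C_{x⁻¹}` are recorded with a proof
argument `x * y = z`, resp. `x⁻¹ = y`, so that no transport between fibres is needed. -/
structure FellBundle (G : Type u) [Group G] [TopologicalSpace G] where
  /-- the fibres `C_x` -/
  Fiber : G → Type v
  [normedAddCommGroup : ∀ x, NormedAddCommGroup (Fiber x)]
  [normedSpace : ∀ x, NormedSpace ℂ (Fiber x)]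
  [completeSpace : ∀ x, CompleteSpace (Fiber x)]
  /-- the topology of the bundle space `⨆ x, C_x` -/
  [topology : TopologicalSpace (Bundle.TotalSpace Unit Fiber)]
  continuous_proj : Continuous fun p : Bundle.TotalSpace Unit Fiber => p.proj
  isOpenMap_proj : IsOpenMap fun p : Bundle.TotalSpace Unit Fiber => p.proj
  continuous_norm : Continuous fun p : Bundle.TotalSpace Unit Fiber => ‖p.snd‖
  /-- addition is continuous on the fibre product, which carries the topology induced by its
  inclusion into the square of the bundle space -/
  continuous_add :
    Continuous[TopologicalSpace.induced
        (fun p : Σ x, Fiber x × Fiber x =>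
          ((⟨p.1, p.2.1⟩, ⟨p.1, p.2.2⟩) :
            Bundle.TotalSpace Unit Fiber × Bundle.TotalSpace Unit Fiber)) inferInstance,
        topology]
      fun p : Σ x, Fiber x × Fiber x => ⟨p.1, p.2.1 + p.2.2⟩
  continuous_const_smul : ∀ c : ℂ,
    Continuous fun p : Bundle.TotalSpace Unit Fiber =>
      (⟨p.proj, c • p.snd⟩ : Bundle.TotalSpace Unit Fiber)
  /-- if `‖b i‖ → 0` and the base points of `b i` converge to `x`, then `b i → 0_x` -/
  tendsto_zero : ∀ x : G,
    comap (fun p : Bundle.TotalSpace Unit Fiber => p.proj) (𝓝 x) ⊓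
      comap (fun p : Bundle.TotalSpace Unit Fiber => ‖p.snd‖) (𝓝 0) ≤ 𝓝 ⟨x, 0⟩
  /-- the multiplication `C_x × C_y → C_z`, where `z = x * y` -/
  mul : ∀ {x y z : G}, x * y = z → Fiber x → Fiber y → Fiber z
  mul_add : ∀ {x y z : G} (h : x * y = z) (a : Fiber x) (b c : Fiber y),
    mul h a (b + c) = mul h a b + mul h a c
  add_mul : ∀ {x y z : G} (h : x * y = z) (a b : Fiber x) (c : Fiber y),
    mul h (a + b) c = mul h a c + mul h b c
  smul_mul : ∀ {x y z : G} (h : x * y = z) (r : ℂ) (a : Fiber x) (b : Fiber y),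
    mul h (r • a) b = r • mul h a b
  mul_smul : ∀ {x y z : G} (h : x * y = z) (r : ℂ) (a : Fiber x) (b : Fiber y),
    mul h a (r • b) = r • mul h a b
  mul_assoc : ∀ {x y z xy yz xyz : G} (hxy : x * y = xy) (hyz : y * z = yz)
    (hl : xy * z = xyz) (hr : x * yz = xyz) (a : Fiber x) (b : Fiber y) (c : Fiber z),
    mul hl (mul hxy a b) c = mul hr a (mul hyz b c)
  norm_mul_le : ∀ {x y z : G} (h : x * y = z) (a : Fiber x) (b : Fiber y),
    ‖mul h a b‖ ≤ ‖a‖ * ‖b‖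
  continuous_mul :
    Continuous fun p : Bundle.TotalSpace Unit Fiber × Bundle.TotalSpace Unit Fiber =>
      (⟨p.1.proj * p.2.proj, mul rfl p.1.snd p.2.snd⟩ : Bundle.TotalSpace Unit Fiber)
  /-- the involution `C_x → C_y`, where `y = x⁻¹` -/
  star : ∀ {x y : G}, x⁻¹ = y → Fiber x → Fiber y
  star_add : ∀ {x y : G} (h : x⁻¹ = y) (a b : Fiber x), star h (a + b) = star h a + star h b
  star_smul : ∀ {x y : G} (h : x⁻¹ = y) (r : ℂ) (a : Fiber x),
    star h (r • a) = (starRingEnd ℂ) r • star h a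
  star_mul : ∀ {x y z x' y' z' : G} (h : x * y = z) (hx : x⁻¹ = x') (hy : y⁻¹ = y')
    (hz : z⁻¹ = z') (h' : y' * x' = z') (a : Fiber x) (b : Fiber y),
    star hz (mul h a b) = mul h' (star hy b) (star hx a)
  star_star : ∀ {x y : G} (h : x⁻¹ = y) (h' : y⁻¹ = x) (a : Fiber x), star h' (star h a) = a
  norm_star : ∀ {x y : G} (h : x⁻¹ = y) (a : Fiber x), ‖star h a‖ = ‖a‖
  continuous_star :
    Continuous fun p : Bundle.TotalSpace Unit Fiber =>
      (⟨p.proj⁻¹, star rfl p.snd⟩ : Bundle.TotalSpace Unit Fiber)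
  norm_star_mul_self : ∀ {x y : G} (h : x⁻¹ = y) (h' : y * x = 1) (a : Fiber x),
    ‖mul h' (star h a) a‖ = ‖a‖ ^ 2
  /-- `a* a` is a positive element of the `C*`-algebra `C_e` -/
  star_mul_self_nonneg : ∀ {x y : G} (h : x⁻¹ = y) (h' : y * x = 1) (a : Fiber x),
    ∃ c : Fiber 1, mul h' (star h a) a = mul (one_mul 1) (star inv_one c) c

namespace FellBundle

attribute [instance] normedAddCommGroup normedSpace completeSpace topology

section Bundle

variable {G : Type u} [Group G] [TopologicalSpace G] (𝒞 : FellBundle.{u, v} G)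

/-- The bundle space `⨆ x, C_x`. -/
abbrev Total : Type (max u v) := Bundle.TotalSpace Unit 𝒞.Fiber

variable {𝒞} {X : Type*} {l : Filter X}

theorem tendsto_add {f : X → G} {x : G} {s t : ∀ i, 𝒞.Fiber (f i)} {a b : 𝒞.Fiber x}
    (hs : Tendsto (fun i => (⟨f i, s i⟩ : 𝒞.Total)) l (𝓝 ⟨x, a⟩))
    (ht : Tendsto (fun i => (⟨f i, t i⟩ : 𝒞.Total)) l (𝓝 ⟨x, b⟩)) :
    Tendsto (fun i => (⟨f i, s i + t i⟩ : 𝒞.Total)) l (𝓝 ⟨x, a + b⟩) := by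
  let _ : TopologicalSpace (Σ x, 𝒞.Fiber x × 𝒞.Fiber x) :=
    TopologicalSpace.induced (fun p => (((⟨p.1, p.2.1⟩, ⟨p.1, p.2.2⟩) : 𝒞.Total × 𝒞.Total)))
      inferInstance
  have hc := 𝒞.continuous_add.tendsto ⟨x, (a, b)⟩
  refine hc.comp (f := fun i => (⟨f i, (s i, t i)⟩ : Σ x, 𝒞.Fiber x × 𝒞.Fiber x)) ?_
  rw [nhds_induced, tendsto_comap_iff]
  exact hs.prodMk_nhds ht

theorem tendsto_const_smul {f : X → G} {x : G} {s : ∀ i, 𝒞.Fiber (f i)} {a : 𝒞.Fiber x}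
    (c : ℂ) (hs : Tendsto (fun i => (⟨f i, s i⟩ : 𝒞.Total)) l (𝓝 ⟨x, a⟩)) :
    Tendsto (fun i => (⟨f i, c • s i⟩ : 𝒞.Total)) l (𝓝 ⟨x, c • a⟩) :=
  ((𝒞.continuous_const_smul c).tendsto ⟨x, a⟩).comp hs

theorem tendsto_sub {f : X → G} {x : G} {s t : ∀ i, 𝒞.Fiber (f i)} {a b : 𝒞.Fiber x}
    (hs : Tendsto (fun i => (⟨f i, s i⟩ : 𝒞.Total)) l (𝓝 ⟨x, a⟩))
    (ht : Tendsto (fun i => (⟨f i, t i⟩ : 𝒞.Total)) l (𝓝 ⟨x, b⟩)) :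
    Tendsto (fun i => (⟨f i, s i - t i⟩ : 𝒞.Total)) l (𝓝 ⟨x, a - b⟩) := by
  have := tendsto_add hs (tendsto_const_smul (-1) ht)
  simpa only [neg_smul, one_smul, ← sub_eq_add_neg] using this

theorem tendsto_norm {f : X → G} {x : G} {s : ∀ i, 𝒞.Fiber (f i)} {a : 𝒞.Fiber x}
    (hs : Tendsto (fun i => (⟨f i, s i⟩ : 𝒞.Total)) l (𝓝 ⟨x, a⟩)) :
    Tendsto (fun i => ‖s i‖) l (𝓝 ‖a‖) :=
  (𝒞.continuous_norm.tendsto ⟨x, a⟩).comp hs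

theorem tendsto_of_norm_tendsto_zero {f : X → G} {x : G} {s : ∀ i, 𝒞.Fiber (f i)}
    (hf : Tendsto f l (𝓝 x)) (hs : Tendsto (fun i => ‖s i‖) l (𝓝 0)) :
    Tendsto (fun i => (⟨f i, s i⟩ : 𝒞.Total)) l (𝓝 ⟨x, 0⟩) := by
  refine Tendsto.mono_right ?_ (𝒞.tendsto_zero x)
  exact tendsto_inf.2 ⟨tendsto_comap_iff.2 hf, tendsto_comap_iff.2 hs⟩

theorem tendsto_mul {f g h : X → G} {x y z : G} (e : ∀ i, f i * g i = h i) (e0 : x * y = z)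
    {s : ∀ i, 𝒞.Fiber (f i)} {t : ∀ i, 𝒞.Fiber (g i)} {a : 𝒞.Fiber x} {b : 𝒞.Fiber y}
    (hs : Tendsto (fun i => (⟨f i, s i⟩ : 𝒞.Total)) l (𝓝 ⟨x, a⟩))
    (ht : Tendsto (fun i => (⟨g i, t i⟩ : 𝒞.Total)) l (𝓝 ⟨y, b⟩)) :
    Tendsto (fun i => (⟨h i, 𝒞.mul (e i) (s i) (t i)⟩ : 𝒞.Total)) l
      (𝓝 ⟨z, 𝒞.mul e0 a b⟩) := by
  obtain rfl : (fun i => f i * g i) = h := funext e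
  subst e0
  exact (𝒞.continuous_mul.tendsto (⟨x, a⟩, ⟨y, b⟩)).comp (hs.prodMk_nhds ht)

theorem tendsto_star {f g : X → G} {x y : G} (e : ∀ i, (f i)⁻¹ = g i) (e0 : x⁻¹ = y)
    {s : ∀ i, 𝒞.Fiber (f i)} {a : 𝒞.Fiber x}
    (hs : Tendsto (fun i => (⟨f i, s i⟩ : 𝒞.Total)) l (𝓝 ⟨x, a⟩)) :
    Tendsto (fun i => (⟨g i, 𝒞.star (e i) (s i)⟩ : 𝒞.Total)) l (𝓝 ⟨y, 𝒞.star e0 a⟩) := by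
  obtain rfl : (fun i => (f i)⁻¹) = g := funext e
  subst e0
  exact (𝒞.continuous_star.tendsto ⟨x, a⟩).comp hs

theorem tendsto_fiber_iff {x : G} {s : X → 𝒞.Fiber x} {a : 𝒞.Fiber x} :
    Tendsto (fun i => (⟨x, s i⟩ : 𝒞.Total)) l (𝓝 ⟨x, a⟩) ↔ Tendsto s l (𝓝 a) := by
  constructor
  · intro h
    rw [tendsto_iff_norm_sub_tendsto_zero]
    simpa using tendsto_norm (tendsto_sub h (tendsto_const_nhds (x := (⟨x, a⟩ : 𝒞.Total))))
  · intro h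
    rw [tendsto_iff_norm_sub_tendsto_zero] at h
    have := tendsto_add (tendsto_of_norm_tendsto_zero (𝒞 := 𝒞) (f := fun _ => x)
      tendsto_const_nhds h) (tendsto_const_nhds (x := (⟨x, a⟩ : 𝒞.Total)))
    simpa using this

theorem tendsto_of_approx {f : X → G} {x : G} {s : ∀ i, 𝒞.Fiber (f i)} {a : 𝒞.Fiber x}
    (hf : Tendsto f l (𝓝 x))
    (h : ∀ ε > 0, ∃ (t : ∀ i, 𝒞.Fiber (f i)) (b : 𝒞.Fiber x),
      Tendsto (fun i => (⟨f i, t i⟩ : 𝒞.Total)) l (𝓝 ⟨x, b⟩) ∧ ‖b - a‖ ≤ ε ∧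
        ∀ᶠ i in l, ‖s i - t i‖ ≤ ε) :
    Tendsto (fun i => (⟨f i, s i⟩ : 𝒞.Total)) l (𝓝 ⟨x, a⟩) := by
  rw [tendsto_def]
  intro W hW
  -- the sum of an element near `a` and one near `0_x` in the same fibre lies in `W`
  have hadd : ∀ᶠ p in (𝓝 (⟨x, a⟩ : 𝒞.Total)) ×ˢ
      (comap (fun p : 𝒞.Total => p.proj) (𝓝 x) ⊓
        comap (fun p : 𝒞.Total => ‖p.snd‖) (𝓝 0)), ∀ (y : G) (b c : 𝒞.Fiber y),
          p = (⟨y, b⟩, ⟨y, c⟩) → (⟨y, b + c⟩ : 𝒞.Total) ∈ W := by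
    let _ : TopologicalSpace (Σ x, 𝒞.Fiber x × 𝒞.Fiber x) :=
      TopologicalSpace.induced (fun p => (((⟨p.1, p.2.1⟩, ⟨p.1, p.2.2⟩) : 𝒞.Total × 𝒞.Total)))
        inferInstance
    have hc := 𝒞.continuous_add.tendsto ⟨x, (a, 0)⟩
    have hW' : W ∈ 𝓝 (⟨x, a + 0⟩ : 𝒞.Total) := by simpa using hW
    have h1 := hc hW'
    rw [nhds_induced, mem_map, mem_comap, nhds_prod_eq] at h1
    obtain ⟨T, hT, hTW⟩ := h1
    have hT' := Filter.prod_mono le_rfl (𝒞.tendsto_zero x) hT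
    filter_upwards [hT'] with p hp y b c hpe
    subst hpe
    exact hTW (show (⟨y, (b, c)⟩ : Σ x, 𝒞.Fiber x × 𝒞.Fiber x) ∈ _ from hp)
  obtain ⟨W', hW', Z, hZ, hWZ⟩ := Filter.mem_prod_iff.1 hadd
  obtain ⟨U, hU, V, hV, hUV⟩ := mem_inf_iff_superset.1 hZ
  obtain ⟨U', hU', hUU'⟩ := mem_comap.1 hU
  obtain ⟨V', hV', hVV'⟩ := mem_comap.1 hV
  obtain ⟨ε, hε, hεV⟩ := Metric.mem_nhds_iff.1 hV'
  have hfib : ∀ᶠ b in 𝓝 a, (⟨x, b⟩ : 𝒞.Total) ∈ interior W' :=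
    (tendsto_fiber_iff.2 tendsto_id) (isOpen_interior.mem_nhds (mem_interior_iff_mem_nhds.2 hW'))
  obtain ⟨δ, hδ, hδW⟩ := Metric.eventually_nhds_iff.1 hfib
  obtain ⟨t, b, ht, hb, hst⟩ := h (min ε δ / 2) (by positivity)
  have hbW : (⟨x, b⟩ : 𝒞.Total) ∈ interior W' := by
    apply hδW
    rw [dist_eq_norm]
    have := min_le_right ε δ
    linarith
  filter_upwards [ht (isOpen_interior.mem_nhds hbW), hst, hf hU'] with i h1 h2 h3
  have hz : (⟨f i, s i - t i⟩ : 𝒞.Total) ∈ Z := by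
    refine hUV ⟨hUU' h3, hVV' (hεV ?_)⟩
    have := min_le_left ε δ
    simp only [Metric.mem_ball, dist_zero_right, norm_norm]
    linarith
  have := hWZ (Set.mk_mem_prod (interior_subset h1) hz) (f i) (t i) (s i - t i) rfl
  simpa using this

theorem mul_congr {x x' y y' z : G} (Φ Ψ : ∀ x, 𝒞.Fiber x) (h : x * y = z) (h' : x' * y' = z)
    (hx : x = x') (hy : y = y') : 𝒞.mul h (Φ x) (Ψ y) = 𝒞.mul h' (Φ x') (Ψ y') := by
  subst hx hy
  rfl

variable (𝒞)

/-- Left multiplication by an element of a fibre. -/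
noncomputable def mulLeft {x y z : G} (h : x * y = z) (a : 𝒞.Fiber x) :
    𝒞.Fiber y →L[ℂ] 𝒞.Fiber z :=
  LinearMap.mkContinuous
    { toFun := fun b => 𝒞.mul h a b
      map_add' := 𝒞.mul_add h a
      map_smul' := fun r b => 𝒞.mul_smul h r a b } ‖a‖ (𝒞.norm_mul_le h a)

/-- Right multiplication by an element of a fibre. -/
noncomputable def mulRight {x y z : G} (h : x * y = z) (b : 𝒞.Fiber y) :
    𝒞.Fiber x →L[ℂ] 𝒞.Fiber z :=
  LinearMap.mkContinuous
    { toFun := fun a => 𝒞.mul h a b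
      map_add' := fun a c => 𝒞.add_mul h a c b
      map_smul' := fun r a => 𝒞.smul_mul h r a b } ‖b‖
    (fun a => (𝒞.norm_mul_le h a b).trans (mul_comm _ _).le)

/-- The involution between two fibres, as a real linear map. -/
noncomputable def starL {x y : G} (h : x⁻¹ = y) : 𝒞.Fiber x →L[ℝ] 𝒞.Fiber y :=
  LinearMap.mkContinuous
    { toFun := fun a => 𝒞.star h a
      map_add' := 𝒞.star_add h
      map_smul' := fun r a => by
        simpa [Complex.coe_smul] using 𝒞.star_smul h (r : ℂ) a } 1
    (fun a => by simpa using (𝒞.norm_star h a).le)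

theorem mul_zero {x y z : G} (h : x * y = z) (a : 𝒞.Fiber x) : 𝒞.mul h a 0 = 0 :=
  (𝒞.mulLeft h a).map_zero

theorem zero_mul {x y z : G} (h : x * y = z) (b : 𝒞.Fiber y) : 𝒞.mul h 0 b = 0 :=
  (𝒞.mulRight h b).map_zero

theorem star_zero {x y : G} (h : x⁻¹ = y) : 𝒞.star h (0 : 𝒞.Fiber x) = 0 :=
  (𝒞.starL h).map_zero

end Bundle

end FellBundle

/-- A weight on a topological group: a measurable, locally bounded, submultiplicative and
inversion-invariant function with values in `[1, ∞)`. -/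
structure Weight (G : Type u) [Group G] [TopologicalSpace G] [MeasurableSpace G] where
  toFun : G → ℝ
  measurable : Measurable toFun
  locallyBounded : ∀ x, ∃ U ∈ 𝓝 x, ∃ M : ℝ, ∀ y ∈ U, toFun y ≤ M
  one_le : ∀ x, 1 ≤ toFun x
  mul_le : ∀ x y, toFun (x * y) ≤ toFun x * toFun y
  inv : ∀ x, toFun x⁻¹ = toFun x

namespace Weight

variable {G : Type u} [Group G] [TopologicalSpace G] [MeasurableSpace G]

instance : CoeFun (Weight G) fun _ => G → ℝ := ⟨toFun⟩

/-- The constant weight `1`. -/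
instance : One (Weight G) where
  one :=
    { toFun := fun _ => 1
      measurable := measurable_const
      locallyBounded := fun _ => ⟨Set.univ, univ_mem, 1, fun _ _ => le_rfl⟩
      one_le := fun _ => le_rfl
      mul_le := fun _ _ => by simp
      inv := fun _ => rfl }

@[simp] theorem one_apply (x : G) : (1 : Weight G) x = 1 := rfl

/-- A weight is polynomial if `ν (x y) ≤ C (ν x + ν y)` for some constant `C > 0`. -/
def IsPolynomial (ν : Weight G) : Prop :=
  ∃ C : ℝ, 0 < C ∧ ∀ x y, ν (x * y) ≤ C * (ν x + ν y)

theorem nonneg (ν : Weight G) (x : G) : 0 ≤ ν x := zero_le_one.trans (ν.one_le x)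

/-- A weight is bounded on compact sets. -/
theorem exists_bound (ν : Weight G) {K : Set G} (hK : IsCompact K) :
    ∃ M : ℝ, ∀ x ∈ K, ν x ≤ M := by
  refine hK.induction_on (p := fun S => ∃ M : ℝ, ∀ x ∈ S, ν x ≤ M) ⟨0, by simp⟩
    (fun s t hst ⟨M, hM⟩ => ⟨M, fun x hx => hM x (hst hx)⟩) ?_ ?_
  · rintro s t ⟨M, hM⟩ ⟨N, hN⟩
    refine ⟨max M N, ?_⟩
    rintro x (hx | hx)
    · exact (hM x hx).trans (le_max_left _ _)
    · exact (hN x hx).trans (le_max_right _ _)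
  · intro x _
    obtain ⟨U, hU, hM⟩ := ν.locallyBounded x
    exact ⟨U, mem_nhdsWithin_of_mem_nhds hU, hM⟩

theorem integrable_mul [OpensMeasurableSpace G] (ν : Weight G) (μ : Measure G)
    [IsFiniteMeasureOnCompacts μ] {f : G → ℝ} (hf : Continuous f) (hfc : HasCompactSupport f) :
    Integrable (fun x => ν x * f x) μ := by
  obtain ⟨M, hM⟩ := ν.exists_bound hfc
  refine ((hf.integrable_of_hasCompactSupport hfc (μ := μ)).norm.const_mul M).mono'
    (ν.measurable.aestronglyMeasurable.mul
      (hf.integrable_of_hasCompactSupport hfc (μ := μ)).aestronglyMeasurable) ?_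
  refine Eventually.of_forall fun x => ?_
  by_cases hx : x ∈ tsupport f
  · rw [norm_mul, Real.norm_of_nonneg (ν.nonneg x)]
    exact mul_le_mul_of_nonneg_right (hM x hx) (norm_nonneg _)
  · simp [image_eq_zero_of_notMem_tsupport hx]

end Weight

/-- Continuous cross-sections with compact support of the Fell bundle `𝒞`.  The Haar measure `μ`
and the weight `ν` do not enter the definition: they are parameters of the type because the
convolution depends on `μ` and the norm on `μ` and `ν`. -/
structure CcSection {G : Type u} [Group G] [TopologicalSpace G] [MeasurableSpace G]
    (𝒞 : FellBundle.{u, v} G) (μ : Measure G) (ν : Weight G) where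
  toFun : ∀ x, 𝒞.Fiber x
  continuous_toFun : Continuous fun x => (⟨x, toFun x⟩ : 𝒞.Total)
  hasCompactSupport_toFun : HasCompactSupport fun x => ‖toFun x‖

namespace CcSection

open FellBundle

section Linear

variable {G : Type u} [Group G] [TopologicalSpace G] [MeasurableSpace G]
  {𝒞 : FellBundle.{u, v} G} {μ : Measure G} {ν : Weight G}

instance : CoeFun (CcSection 𝒞 μ ν) fun _ => ∀ x, 𝒞.Fiber x := ⟨toFun⟩

theorem toFun_injective : Function.Injective (toFun : CcSection 𝒞 μ ν → ∀ x, 𝒞.Fiber x) := by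
  rintro ⟨f, _, _⟩ ⟨g, _, _⟩ h
  cases h
  rfl

@[ext] theorem ext {Φ Ψ : CcSection 𝒞 μ ν} (h : ∀ x, Φ x = Ψ x) : Φ = Ψ :=
  toFun_injective (funext h)

theorem tendsto (Φ : CcSection 𝒞 μ ν) (x : G) :
    Tendsto (fun x => (⟨x, Φ x⟩ : 𝒞.Total)) (𝓝 x) (𝓝 ⟨x, Φ x⟩) :=
  Φ.continuous_toFun.tendsto x

theorem continuous_norm (Φ : CcSection 𝒞 μ ν) : Continuous fun x => ‖Φ x‖ :=
  𝒞.continuous_norm.comp Φ.continuous_toFun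

theorem apply_eq_zero (Φ : CcSection 𝒞 μ ν) {x : G} (hx : x ∉ tsupport fun y => ‖Φ y‖) :
    Φ x = 0 :=
  norm_eq_zero.1 (image_eq_zero_of_notMem_tsupport (f := fun y => ‖Φ y‖) hx)

instance : Zero (CcSection 𝒞 μ ν) where
  zero :=
    { toFun := fun _ => 0
      continuous_toFun := continuous_iff_continuousAt.2 fun x =>
        tendsto_of_norm_tendsto_zero (f := fun x => x) tendsto_id (by simp)
      hasCompactSupport_toFun := by
        simp only [norm_zero]
        exact HasCompactSupport.zero }

instance : Add (CcSection 𝒞 μ ν) where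
  add Φ Ψ :=
    { toFun := fun x => Φ x + Ψ x
      continuous_toFun := continuous_iff_continuousAt.2 fun x =>
        tendsto_add (f := fun x => x) (Φ.tendsto x) (Ψ.tendsto x)
      hasCompactSupport_toFun :=
        (Φ.hasCompactSupport_toFun.add Ψ.hasCompactSupport_toFun).mono' fun x hx => by
          refine subset_closure ?_
          rw [Function.mem_support] at hx ⊢
          contrapose! hx
          simp only [Pi.add_apply] at hx
          have h1 := norm_nonneg (Φ x)
          have h2 := norm_nonneg (Ψ x)
          exact le_antisymm ((norm_add_le _ _).trans hx.le) (norm_nonneg _) }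

instance {R : Type*} [SMulZeroClass R ℂ] : SMul R (CcSection 𝒞 μ ν) where
  smul r Φ :=
    { toFun := fun x => (r • (1 : ℂ)) • Φ x
      continuous_toFun := continuous_iff_continuousAt.2 fun x =>
        tendsto_const_smul (f := fun x => x) (r • (1 : ℂ)) (Φ.tendsto x)
      hasCompactSupport_toFun := Φ.hasCompactSupport_toFun.mono' fun x hx => by
        refine subset_closure ?_
        rw [Function.mem_support] at hx ⊢
        contrapose! hx
        simp [norm_smul, hx] }

instance : Neg (CcSection 𝒞 μ ν) where
  neg Φ := (-1 : ℂ) • Φ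

instance : Sub (CcSection 𝒞 μ ν) where
  sub Φ Ψ := Φ + (-1 : ℂ) • Ψ

@[simp] theorem zero_apply (x : G) : (0 : CcSection 𝒞 μ ν) x = 0 := rfl

@[simp] theorem add_apply (Φ Ψ : CcSection 𝒞 μ ν) (x : G) : (Φ + Ψ) x = Φ x + Ψ x := rfl

@[simp] theorem smul_apply (r : ℂ) (Φ : CcSection 𝒞 μ ν) (x : G) : (r • Φ) x = r • Φ x := by
  change (r • (1 : ℂ)) • Φ x = r • Φ x
  simp

@[simp] theorem neg_apply (Φ : CcSection 𝒞 μ ν) (x : G) : (-Φ) x = -Φ x := by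
  change ((-1 : ℂ) • Φ) x = -Φ x
  simp

@[simp] theorem sub_apply (Φ Ψ : CcSection 𝒞 μ ν) (x : G) : (Φ - Ψ) x = Φ x - Ψ x := by
  change (Φ + (-1 : ℂ) • Ψ) x = Φ x - Ψ x
  simp [sub_eq_add_neg]

instance : AddCommGroup (CcSection 𝒞 μ ν) :=
  toFun_injective.addCommGroup _ rfl (fun _ _ => rfl) (fun Φ => funext Φ.neg_apply)
    (fun Φ Ψ => funext (Φ.sub_apply Ψ))
    (fun Φ n => funext fun x => by
      change ((n : ℕ) • (1 : ℂ)) • Φ x = n • Φ x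
      simp [← Nat.cast_smul_eq_nsmul ℂ])
    (fun Φ n => funext fun x => by
      change ((n : ℤ) • (1 : ℂ)) • Φ x = n • Φ x
      simp [← Int.cast_smul_eq_zsmul ℂ])

instance : Module ℂ (CcSection 𝒞 μ ν) :=
  toFun_injective.module ℂ ⟨⟨toFun, rfl⟩, fun _ _ => rfl⟩ (fun r Φ => funext (Φ.smul_apply r))

end Linear

section Convolution

variable {G : Type u} [Group G] [TopologicalSpace G] [IsTopologicalGroup G] [MeasurableSpace G]
  [BorelSpace G] {𝒞 : FellBundle.{u, v} G} {μ : Measure G} {ν : Weight G}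

/-- The integrand `y ↦ Φ y • Ψ (y⁻¹ x)` of the convolution. -/
def kernel (Φ Ψ : CcSection 𝒞 μ ν) (x y : G) : 𝒞.Fiber x :=
  𝒞.mul (mul_inv_cancel_left y x) (Φ y) (Ψ (y⁻¹ * x))

theorem kernel_tendsto (Φ Ψ : CcSection 𝒞 μ ν) (x y : G) :
    Tendsto (fun p : G × G => (⟨p.1, kernel Φ Ψ p.1 p.2⟩ : 𝒞.Total)) (𝓝 (x, y))
      (𝓝 ⟨x, kernel Φ Ψ x y⟩) := by
  refine tendsto_mul (f := fun p : G × G => p.2) (g := fun p : G × G => p.2⁻¹ * p.1)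
    (h := fun p : G × G => p.1) (fun p => mul_inv_cancel_left p.2 p.1) (mul_inv_cancel_left y x)
    ?_ ?_
  · exact (Φ.tendsto y).comp (continuous_snd.tendsto (x, y))
  · exact (Ψ.tendsto (y⁻¹ * x)).comp
      ((by fun_prop : Continuous fun p : G × G => p.2⁻¹ * p.1).tendsto (x, y))

theorem kernel_eq_zero (Φ Ψ : CcSection 𝒞 μ ν) (x : G) {y : G}
    (hy : y ∉ tsupport fun y => ‖Φ y‖) : kernel Φ Ψ x y = 0 := by
  rw [kernel, Φ.apply_eq_zero hy, 𝒞.zero_mul]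

theorem continuous_kernel (Φ Ψ : CcSection 𝒞 μ ν) (x : G) : Continuous (kernel Φ Ψ x) :=
  continuous_iff_continuousAt.2 fun y => tendsto_fiber_iff.1 <|
    (kernel_tendsto Φ Ψ x y).comp ((Continuous.prodMk_right x).tendsto y)

theorem hasCompactSupport_kernel (Φ Ψ : CcSection 𝒞 μ ν) (x : G) :
    HasCompactSupport (kernel Φ Ψ x) :=
  Φ.hasCompactSupport_toFun.mono' fun y hy => by
    by_contra h
    exact hy (kernel_eq_zero Φ Ψ x h)

theorem integrable_kernel [IsFiniteMeasureOnCompacts μ] (Φ Ψ : CcSection 𝒞 μ ν) (x : G) :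
    Integrable (kernel Φ Ψ x) μ :=
  (continuous_kernel Φ Ψ x).integrable_of_hasCompactSupport (hasCompactSupport_kernel Φ Ψ x)

theorem convolution_tendsto [IsFiniteMeasureOnCompacts μ] (Φ Ψ : CcSection 𝒞 μ ν) (x₀ : G) :
    Tendsto (fun x => (⟨x, ∫ y, kernel Φ Ψ x y ∂μ⟩ : 𝒞.Total)) (𝓝 x₀)
      (𝓝 ⟨x₀, ∫ y, kernel Φ Ψ x₀ y ∂μ⟩) := by
  set K : Set G := tsupport fun y => ‖Φ y‖ with hKdef
  have hK : IsCompact K := Φ.hasCompactSupport_toFun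
  have hKm : MeasurableSet K := (isClosed_tsupport _).measurableSet
  have : IsFiniteMeasure (μ.restrict K) := ⟨by simpa using hK.measure_lt_top⟩
  have hint : ∀ (x : G) (T : Set G), IntegrableOn (kernel Φ Ψ x) T (μ.restrict K) := fun x T =>
    (integrable_kernel Φ Ψ x).restrict.restrict
  -- local approximation of the integral by continuous cross-sections
  have key : ∀ δ > 0, ∃ S' : Set G, MeasurableSet S' ∧ K ⊆ S' ∧ ∀ T ⊆ S', MeasurableSet T →
      ∃ t : ∀ x, 𝒞.Fiber x, Tendsto (fun x => (⟨x, t x⟩ : 𝒞.Total)) (𝓝 x₀) (𝓝 ⟨x₀, t x₀⟩) ∧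
        ∀ᶠ x in 𝓝 x₀, ‖(∫ y in T, kernel Φ Ψ x y ∂(μ.restrict K)) - t x‖
          ≤ δ * (μ.restrict K).real T := by
    intro δ hδ
    refine hK.induction_on (p := fun S => ∃ S' : Set G, MeasurableSet S' ∧ S ⊆ S' ∧
      ∀ T ⊆ S', MeasurableSet T → ∃ t : ∀ x, 𝒞.Fiber x,
        Tendsto (fun x => (⟨x, t x⟩ : 𝒞.Total)) (𝓝 x₀) (𝓝 ⟨x₀, t x₀⟩) ∧
        ∀ᶠ x in 𝓝 x₀, ‖(∫ y in T, kernel Φ Ψ x y ∂(μ.restrict K)) - t x‖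
          ≤ δ * (μ.restrict K).real T) ?_ ?_ ?_ ?_
    · refine ⟨∅, MeasurableSet.empty, le_rfl, fun T hT _ => ⟨fun _ => 0,
        (0 : CcSection 𝒞 μ ν).tendsto x₀, Eventually.of_forall fun x => ?_⟩⟩
      obtain rfl : T = ∅ := Set.subset_empty_iff.1 hT
      simp
    · rintro s t hst ⟨S', h1, h2, h3⟩
      exact ⟨S', h1, hst.trans h2, h3⟩
    · rintro s₁ s₂ ⟨S₁, h1, h2, h3⟩ ⟨S₂, k1, k2, k3⟩
      refine ⟨S₁ ∪ S₂, h1.union k1, Set.union_subset_union h2 k2, fun T hT hTm => ?_⟩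
      obtain ⟨t₁, ht₁, hb₁⟩ := h3 (T ∩ S₁) Set.inter_subset_right (hTm.inter h1)
      obtain ⟨t₂, ht₂, hb₂⟩ := k3 (T \ S₁)
        (fun y hy => (hT hy.1).resolve_left hy.2) (hTm.diff h1)
      refine ⟨fun x => t₁ x + t₂ x, tendsto_add (f := fun x => x) ht₁ ht₂, ?_⟩
      filter_upwards [hb₁, hb₂] with x hx₁ hx₂
      rw [← integral_inter_add_sdiff h1 (hint x T), add_sub_add_comm,
        ← measureReal_inter_add_sdiff (μ := μ.restrict K) (s := T) h1, _root_.mul_add]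
      exact (norm_add_le _ _).trans (add_le_add hx₁ hx₂)
    · intro y₀ _
      have hd : Tendsto (fun p : G × G => ‖kernel Φ Ψ p.1 p.2 - kernel Φ Ψ p.1 y₀‖)
          (𝓝 (x₀, y₀)) (𝓝 0) := by
        have h1 := tendsto_norm (tendsto_sub (kernel_tendsto Φ Ψ x₀ y₀)
          (((kernel_tendsto Φ Ψ x₀ y₀).comp
            ((Continuous.prodMk_left y₀).tendsto x₀)).comp (continuous_fst.tendsto (x₀, y₀))))
        simpa using h1
      have hev := hd.eventually (gt_mem_nhds hδ)
      rw [nhds_prod_eq] at hev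
      obtain ⟨U, hU, V, hV, hUV⟩ := Filter.mem_prod_iff.1 hev
      refine ⟨interior V, mem_nhdsWithin_of_mem_nhds (interior_mem_nhds.2 hV), interior V,
        isOpen_interior.measurableSet, le_rfl, fun T hT hTm => ?_⟩
      refine ⟨fun x => (((μ.restrict K).real T : ℝ) : ℂ) • kernel Φ Ψ x y₀,
        tendsto_const_smul (f := fun x => x) _ ((kernel_tendsto Φ Ψ x₀ y₀).comp
          ((Continuous.prodMk_left y₀).tendsto x₀)), ?_⟩
      filter_upwards [hU] with x hx
      have hc : (((μ.restrict K).real T : ℝ) : ℂ) • kernel Φ Ψ x y₀ =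
          ∫ _ in T, kernel Φ Ψ x y₀ ∂(μ.restrict K) := by
        rw [setIntegral_const, Complex.coe_smul]
      rw [hc, ← integral_sub (hint x T) (integrable_const _)]
      refine norm_setIntegral_le_of_norm_le_const (measure_lt_top _ _) fun y hy => ?_
      exact (hUV (Set.mk_mem_prod hx (interior_subset (hT hy)))).le
  refine tendsto_of_approx (f := fun x => x) tendsto_id fun ε hε => ?_
  set m := (μ.restrict K).real K with hm
  have hm0 : 0 ≤ m := measureReal_nonneg
  obtain ⟨S', _, hKS, hS'⟩ := key (ε / (m + 1)) (by positivity)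
  obtain ⟨t, ht, hb⟩ := hS' K hKS hKm
  have hle : ε / (m + 1) * m ≤ ε := by
    rw [div_mul_eq_mul_div, div_le_iff₀ (by positivity)]
    nlinarith
  have heq : ∀ x, ∫ y in K, kernel Φ Ψ x y ∂(μ.restrict K) = ∫ y, kernel Φ Ψ x y ∂μ := fun x => by
    rw [Measure.restrict_restrict hKm, Set.inter_self]
    exact setIntegral_eq_integral_of_forall_compl_eq_zero fun y hy => kernel_eq_zero Φ Ψ x hy
  simp only [heq] at hb
  refine ⟨t, t x₀, ht, ?_, hb.mono fun x hx => hx.trans hle⟩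
  rw [norm_sub_rev]
  exact hb.self_of_nhds.trans hle

variable [IsFiniteMeasureOnCompacts μ]

/-- The convolution `(Φ * Ψ)(x) = ∫ Φ(y) • Ψ(y⁻¹ x) dy`. -/
noncomputable instance : Mul (CcSection 𝒞 μ ν) where
  mul Φ Ψ :=
    { toFun := fun x => ∫ y, 𝒞.mul (mul_inv_cancel_left y x) (Φ y) (Ψ (y⁻¹ * x)) ∂μ
      continuous_toFun := continuous_iff_continuousAt.2 (convolution_tendsto Φ Ψ)
      hasCompactSupport_toFun := by
        have hK := Φ.hasCompactSupport_toFun.isCompact.mul Ψ.hasCompactSupport_toFun.isCompact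
        refine HasCompactSupport.intro hK fun x hx => ?_
        · rw [norm_eq_zero]
          refine integral_eq_zero_of_ae (Eventually.of_forall fun y => ?_)
          by_cases hy : y ∈ tsupport fun y => ‖Φ y‖
          · have h2 : y⁻¹ * x ∉ tsupport fun y => ‖Ψ y‖ := fun h =>
              hx (Set.mem_mul.2 ⟨y, hy, _, h, mul_inv_cancel_left y x⟩)
            simp [Ψ.apply_eq_zero h2, 𝒞.mul_zero]
          · exact kernel_eq_zero Φ Ψ x hy }

theorem mul_apply (Φ Ψ : CcSection 𝒞 μ ν) (x : G) : (Φ * Ψ) x = ∫ y, kernel Φ Ψ x y ∂μ := rfl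

end Convolution

section Algebra

open scoped Pointwise

variable {G : Type u} [Group G] [TopologicalSpace G] [IsTopologicalGroup G] [MeasurableSpace G]
  [BorelSpace G] {𝒞 : FellBundle.{u, v} G} {μ : Measure G} [μ.IsHaarMeasure] {ν : Weight G}

theorem mul_assoc' (Φ Ψ Θ : CcSection 𝒞 μ ν) : Φ * Ψ * Θ = Φ * (Ψ * Θ) := by
  ext x
  let F : G → G → 𝒞.Fiber x := fun y z =>
    𝒞.mul (mul_inv_cancel_left z x) (Φ z) (kernel Ψ Θ (z⁻¹ * x) (z⁻¹ * y))
  have hF : ∀ y z, 𝒞.mul (mul_inv_cancel_left y x) (kernel Φ Ψ y z) (Θ (y⁻¹ * x)) = F y z := by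
    intro y z
    have h1 : z⁻¹ * y * (y⁻¹ * x) = z⁻¹ * x := by group
    have h2 := 𝒞.mul_assoc (mul_inv_cancel_left z y) h1 (mul_inv_cancel_left y x)
      (mul_inv_cancel_left z x) (Φ z) (Ψ (z⁻¹ * y)) (Θ (y⁻¹ * x))
    refine h2.trans ?_
    refine congrArg (𝒞.mul (mul_inv_cancel_left z x) (Φ z)) ?_
    exact mul_congr (𝒞 := 𝒞) Ψ Θ h1 (mul_inv_cancel_left (z⁻¹ * y) (z⁻¹ * x)) rfl (by group)
  have hcont : Continuous F.uncurry := by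
    refine continuous_iff_continuousAt.2 fun ⟨y, z⟩ => ?_
    refine tendsto_fiber_iff.1 ?_
    refine tendsto_mul (f := fun p : G × G => p.2) (g := fun p : G × G => p.2⁻¹ * x)
      (h := fun _ : G × G => x) (fun p => mul_inv_cancel_left p.2 x) (mul_inv_cancel_left z x)
      ((Φ.tendsto z).comp (continuous_snd.tendsto (y, z))) ?_
    exact (kernel_tendsto Ψ Θ (z⁻¹ * x) (z⁻¹ * y)).comp
      ((by fun_prop : Continuous fun p : G × G => (p.2⁻¹ * x, p.2⁻¹ * p.1)).tendsto (y, z))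
  have hsupp : HasCompactSupport F.uncurry := by
    refine HasCompactSupport.intro
      ((Φ.hasCompactSupport_toFun.isCompact.mul Ψ.hasCompactSupport_toFun.isCompact).prod
        Φ.hasCompactSupport_toFun.isCompact) ?_
    rintro ⟨y, z⟩ hyz
    change 𝒞.mul _ (Φ z) (kernel Ψ Θ (z⁻¹ * x) (z⁻¹ * y)) = 0
    by_cases hz : z ∈ tsupport fun y => ‖Φ y‖
    · have h2 : z⁻¹ * y ∉ tsupport fun y => ‖Ψ y‖ := fun h =>
        hyz ⟨Set.mem_mul.2 ⟨z, hz, _, h, mul_inv_cancel_left z y⟩, hz⟩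
      rw [kernel_eq_zero Ψ Θ _ h2, 𝒞.mul_zero]
    · rw [Φ.apply_eq_zero hz, 𝒞.zero_mul]
  calc (Φ * Ψ * Θ) x
      = ∫ y, 𝒞.mulRight (mul_inv_cancel_left y x) (Θ (y⁻¹ * x)) (∫ z, kernel Φ Ψ y z ∂μ) ∂μ := rfl
    _ = ∫ y, ∫ z, F y z ∂μ ∂μ := by
        refine integral_congr_ae (Eventually.of_forall fun y => ?_)
        refine (ContinuousLinearMap.integral_comp_comm _ (integrable_kernel Φ Ψ y)).symm.trans ?_
        exact integral_congr_ae (Eventually.of_forall fun z => hF y z)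
    _ = ∫ z, ∫ y, F y z ∂μ ∂μ := integral_integral_swap_of_hasCompactSupport hcont hsupp
    _ = ∫ z, 𝒞.mulLeft (mul_inv_cancel_left z x) (Φ z)
          (∫ y, kernel Ψ Θ (z⁻¹ * x) y ∂μ) ∂μ := by
        refine integral_congr_ae (Eventually.of_forall fun z => ?_)
        have h3 := integral_mul_left_eq_self (μ := μ) (fun y => kernel Ψ Θ (z⁻¹ * x) y) z⁻¹
        simp only
        rw [← h3]
        exact (𝒞.mulLeft (mul_inv_cancel_left z x) (Φ z)).integral_comp_comm
          ((integrable_kernel Ψ Θ (z⁻¹ * x)).comp_mul_left z⁻¹)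
    _ = (Φ * (Ψ * Θ)) x := rfl

noncomputable instance : NonUnitalRing (CcSection 𝒞 μ ν) where
  left_distrib Φ Ψ Θ := by
    ext x
    rw [add_apply, mul_apply, mul_apply, mul_apply,
      ← integral_add (integrable_kernel Φ Ψ x) (integrable_kernel Φ Θ x)]
    exact integral_congr_ae (Eventually.of_forall fun y => 𝒞.mul_add _ _ _ _)
  right_distrib Φ Ψ Θ := by
    ext x
    rw [add_apply, mul_apply, mul_apply, mul_apply,
      ← integral_add (integrable_kernel Φ Θ x) (integrable_kernel Ψ Θ x)]
    exact integral_congr_ae (Eventually.of_forall fun y => 𝒞.add_mul _ _ _ _)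
  zero_mul Φ := by
    ext x
    rw [mul_apply]
    exact integral_eq_zero_of_ae (Eventually.of_forall fun y => 𝒞.zero_mul _ _)
  mul_zero Φ := by
    ext x
    rw [mul_apply]
    exact integral_eq_zero_of_ae (Eventually.of_forall fun y => 𝒞.mul_zero _ _)
  mul_assoc := mul_assoc'

instance : IsScalarTower ℂ (CcSection 𝒞 μ ν) (CcSection 𝒞 μ ν) where
  smul_assoc r Φ Ψ := by
    ext x
    rw [smul_eq_mul, smul_eq_mul, smul_apply, mul_apply, mul_apply, ← integral_smul]
    exact integral_congr_ae (Eventually.of_forall fun y => by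
      simp only [kernel, smul_apply, 𝒞.smul_mul])

instance : SMulCommClass ℂ (CcSection 𝒞 μ ν) (CcSection 𝒞 μ ν) where
  smul_comm r Φ Ψ := by
    ext x
    rw [smul_eq_mul, smul_eq_mul, smul_apply, mul_apply, mul_apply, ← integral_smul]
    exact integral_congr_ae (Eventually.of_forall fun y => by
      simp only [kernel, smul_apply, 𝒞.mul_smul])

/-- The involution `Φ^*(x) = Φ(x⁻¹)^•`. -/
instance : Star (CcSection 𝒞 μ ν) where
  star Φ :=
    { toFun := fun x => 𝒞.star (inv_inv x) (Φ x⁻¹)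
      continuous_toFun := continuous_iff_continuousAt.2 fun x =>
        tendsto_star (f := fun x => x⁻¹) (g := fun x => x) inv_inv (inv_inv x)
          ((Φ.tendsto x⁻¹).comp (continuous_inv.tendsto x))
      hasCompactSupport_toFun := by
        simp only [𝒞.norm_star]
        exact Φ.hasCompactSupport_toFun.comp_homeomorph (Homeomorph.inv G) }

theorem star_apply (Φ : CcSection 𝒞 μ ν) (x : G) :
    (star Φ) x = 𝒞.star (inv_inv x) (Φ x⁻¹) := rfl

noncomputable instance : StarRing (CcSection 𝒞 μ ν) where
  star_involutive Φ := by
    ext x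
    have key : ∀ (y : G) (_ : y = x) (h : y⁻¹ = x⁻¹) (h' : (x⁻¹)⁻¹ = x),
        𝒞.star h' (𝒞.star h (Φ y)) = Φ x := by
      rintro y rfl h h'
      exact 𝒞.star_star _ _ _
    exact key (x⁻¹)⁻¹ (inv_inv x) _ _
  star_add Φ Ψ := by
    ext x
    exact 𝒞.star_add _ _ _
  star_mul Φ Ψ := by
    ext x
    have hcongr : ∀ (y y' z : G) (_ : y = y') (h : y⁻¹ = z) (h' : y'⁻¹ = z) (Θ : CcSection 𝒞 μ ν),
        𝒞.star h (Θ y) = 𝒞.star h' (Θ y') := by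
      rintro y y' z rfl h h' Θ
      rfl
    rw [mul_apply, ← integral_mul_left_eq_self (μ := μ) (kernel (star Ψ) (star Φ) x) x]
    refine ((𝒞.starL (inv_inv x)).integral_comp_comm (integrable_kernel Φ Ψ x⁻¹)).symm.trans ?_
    refine integral_congr_ae (Eventually.of_forall fun y => ?_)
    have hx : y⁻¹ = (x * y)⁻¹ * x := by group
    have hy : (y⁻¹ * x⁻¹)⁻¹ = x * y := by group
    refine (𝒞.star_mul (mul_inv_cancel_left y x⁻¹) hx hy (inv_inv x)
      (mul_inv_cancel_left (x * y) x) (Φ y) (Ψ (y⁻¹ * x⁻¹))).trans ?_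
    change _ = 𝒞.mul _ (𝒞.star _ (Ψ _)) (𝒞.star _ (Φ _))
    rw [hcongr _ _ _ (by group) hy (inv_inv (x * y)) Ψ,
      hcongr _ _ _ (by group) hx (inv_inv ((x * y)⁻¹ * x)) Φ]

instance : StarModule ℂ (CcSection 𝒞 μ ν) where
  star_smul r Φ := by
    ext x
    rw [star_apply, smul_apply, smul_apply, star_apply]
    exact 𝒞.star_smul _ _ _

/-- The norm of `L^{1,ν}`. -/
noncomputable instance : Norm (CcSection 𝒞 μ ν) where
  norm Φ := ∫ x, ν x * ‖Φ x‖ ∂μ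

theorem norm_def (Φ : CcSection 𝒞 μ ν) : ‖Φ‖ = ∫ x, ν x * ‖Φ x‖ ∂μ := rfl

theorem integrable_norm (Φ : CcSection 𝒞 μ ν) : Integrable (fun x => ν x * ‖Φ x‖) μ :=
  ν.integrable_mul μ Φ.continuous_norm Φ.hasCompactSupport_toFun

theorem norm_nonneg' (Φ : CcSection 𝒞 μ ν) : 0 ≤ ‖Φ‖ :=
  integral_nonneg fun x => mul_nonneg (ν.nonneg x) (norm_nonneg _)

theorem normedSpaceCore : NormedSpace.Core ℂ (CcSection 𝒞 μ ν) where
  norm_nonneg := norm_nonneg'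
  norm_smul r Φ := by
    rw [norm_def, norm_def, ← integral_const_mul]
    refine integral_congr_ae (Eventually.of_forall fun x => ?_)
    simp only [smul_apply, norm_smul]
    ring
  norm_triangle Φ Ψ := by
    rw [norm_def, norm_def, norm_def, ← integral_add Φ.integrable_norm Ψ.integrable_norm]
    refine integral_mono (Φ + Ψ).integrable_norm (Φ.integrable_norm.add Ψ.integrable_norm)
      fun x => ?_
    simp only [add_apply, ← _root_.mul_add]
    exact mul_le_mul_of_nonneg_left (norm_add_le _ _) (ν.nonneg x)
  norm_eq_zero_iff Φ := by
    constructor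
    · intro h
      by_contra hne
      obtain ⟨x, hx⟩ : ∃ x, Φ x ≠ 0 := by
        by_contra hcon
        push Not at hcon
        exact hne (ext hcon)
      have h1 := Φ.continuous_norm.integral_pos_of_hasCompactSupport_nonneg_nonzero (μ := μ)
        Φ.hasCompactSupport_toFun (fun x => norm_nonneg _) (norm_ne_zero_iff.2 hx)
      have h2 : ∫ x, ‖Φ x‖ ∂μ ≤ ‖Φ‖ := by
        refine integral_mono
          (Φ.continuous_norm.integrable_of_hasCompactSupport Φ.hasCompactSupport_toFun)
          Φ.integrable_norm fun x => ?_
        exact le_mul_of_one_le_left (norm_nonneg _) (ν.one_le x)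
      linarith
    · rintro rfl
      simp [norm_def]

noncomputable instance : NormedAddCommGroup (CcSection 𝒞 μ ν) :=
  NormedAddCommGroup.ofCore normedSpaceCore

noncomputable instance : NormedSpace ℂ (CcSection 𝒞 μ ν) :=
  NormedSpace.ofCore normedSpaceCore

theorem norm_mul_le' (Φ Ψ : CcSection 𝒞 μ ν) : ‖Φ * Ψ‖ ≤ ‖Φ‖ * ‖Ψ‖ := by
  let f : G → G → ℝ := fun x y => ‖Φ y‖ * ‖Ψ (y⁻¹ * x)‖
  have hfc : Continuous f.uncurry :=
    (Φ.continuous_norm.comp continuous_snd).mul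
      (Ψ.continuous_norm.comp (by fun_prop : Continuous fun p : G × G => p.2⁻¹ * p.1))
  have hf0 : ∀ x y, (y ∉ tsupport fun y => ‖Φ y‖) → f x y = 0 := fun x y hy => by
    simp [f, Φ.apply_eq_zero hy]
  have hf1 : ∀ x y, x ∉ (tsupport fun y => ‖Φ y‖) * (tsupport fun y => ‖Ψ y‖) → f x y = 0 := by
    intro x y hx
    by_cases hy : y ∈ tsupport fun y => ‖Φ y‖
    · have h2 : y⁻¹ * x ∉ tsupport fun y => ‖Ψ y‖ := fun h =>
        hx (Set.mem_mul.2 ⟨y, hy, _, h, mul_inv_cancel_left y x⟩)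
      simp [f, Ψ.apply_eq_zero h2]
    · exact hf0 x y hy
  have hfs : HasCompactSupport f.uncurry := by
    refine HasCompactSupport.intro
      ((Φ.hasCompactSupport_toFun.isCompact.mul Ψ.hasCompactSupport_toFun.isCompact).prod
        Φ.hasCompactSupport_toFun.isCompact) ?_
    rintro ⟨x, y⟩ hxy
    by_cases hy : y ∈ tsupport fun y => ‖Φ y‖
    · exact hf1 x y fun hx => hxy ⟨hx, hy⟩
    · exact hf0 x y hy
  have hfi : ∀ x, Integrable (f x) μ := fun x =>
    (hfc.comp (Continuous.prodMk_right x)).integrable_of_hasCompactSupport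
      (HasCompactSupport.intro Φ.hasCompactSupport_toFun.isCompact fun y hy => hf0 x y hy)
  have hFc : Continuous fun x => ∫ y, f x y ∂μ := by
    rw [← continuousOn_univ]
    exact continuousOn_integral_of_compact_support Φ.hasCompactSupport_toFun.isCompact
      hfc.continuousOn fun x y _ hy => hf0 x y hy
  have hFs : HasCompactSupport fun x => ∫ y, f x y ∂μ :=
    HasCompactSupport.intro
      (Φ.hasCompactSupport_toFun.isCompact.mul Ψ.hasCompactSupport_toFun.isCompact)
      fun x hx => integral_eq_zero_of_ae (Eventually.of_forall fun y => hf1 x y hx)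
  -- the measure `ν(x) dx`
  let μ' : Measure G := μ.withDensity fun x => ENNReal.ofReal (ν x)
  have hμ' : ∀ g : G → ℝ, ∫ x, g x ∂μ' = ∫ x, ν x * g x ∂μ := fun g => by
    rw [integral_withDensity_eq_integral_toReal_smul ν.measurable.ennreal_ofReal
      (Eventually.of_forall fun x => ENNReal.ofReal_lt_top)]
    refine integral_congr_ae (Eventually.of_forall fun x => ?_)
    simp [ENNReal.toReal_ofReal (ν.nonneg x)]
  have : IsFiniteMeasureOnCompacts μ' := by
    refine ⟨fun K hK => ?_⟩
    obtain ⟨M, hM⟩ := ν.exists_bound hK.closure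
    refine (measure_mono subset_closure).trans_lt ?_
    rw [withDensity_apply _ isClosed_closure.measurableSet]
    refine (setLIntegral_mono measurable_const fun x hx =>
      ENNReal.ofReal_le_ofReal (hM x hx)).trans_lt ?_
    rw [setLIntegral_const]
    exact ENNReal.mul_lt_top ENNReal.ofReal_lt_top hK.closure.measure_lt_top
  calc ‖Φ * Ψ‖ ≤ ∫ x, ν x * ∫ y, f x y ∂μ ∂μ := by
        refine integral_mono (Φ * Ψ).integrable_norm (ν.integrable_mul μ hFc hFs) fun x => ?_
        refine mul_le_mul_of_nonneg_left ?_ (ν.nonneg x)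
        rw [mul_apply]
        exact norm_integral_le_of_norm_le (hfi x)
          (Eventually.of_forall fun y => 𝒞.norm_mul_le _ _ _)
    _ = ∫ x, ∫ y, f x y ∂μ ∂μ' := (hμ' _).symm
    _ = ∫ y, ∫ x, f x y ∂μ' ∂μ := integral_integral_swap_of_hasCompactSupport hfc hfs
    _ = ∫ y, ‖Φ y‖ * ∫ x, ν (y * x) * ‖Ψ x‖ ∂μ ∂μ := by
        refine integral_congr_ae (Eventually.of_forall fun y => ?_)
        simp only [hμ', f]
        rw [← integral_mul_left_eq_self (μ := μ) (fun x => ν x * (‖Φ y‖ * ‖Ψ (y⁻¹ * x)‖)) y,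
          ← integral_const_mul]
        refine integral_congr_ae (Eventually.of_forall fun x => ?_)
        have hx : ∀ z, z = x → ‖Ψ z‖ = ‖Ψ x‖ := by
          rintro z rfl
          rfl
        simp only [hx _ (inv_mul_cancel_left y x)]
        ring
    _ ≤ ∫ y, (ν y * ‖Φ y‖) * ‖Ψ‖ ∂μ := by
        refine integral_mono_of_nonneg (Eventually.of_forall fun y => ?_)
          (Φ.integrable_norm.mul_const _) (Eventually.of_forall fun y => ?_)
        · exact mul_nonneg (norm_nonneg _)
            (integral_nonneg fun x => mul_nonneg (ν.nonneg _) (norm_nonneg _))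
        · simp only
          rw [mul_comm (ν y), _root_.mul_assoc, norm_def Ψ, ← integral_const_mul (ν y)]
          refine mul_le_mul_of_nonneg_left ?_ (norm_nonneg _)
          refine integral_mono_of_nonneg (Eventually.of_forall fun x =>
            mul_nonneg (ν.nonneg _) (norm_nonneg _)) (Ψ.integrable_norm.const_mul _)
            (Eventually.of_forall fun x => ?_)
          simp only
          rw [← _root_.mul_assoc]
          exact mul_le_mul_of_nonneg_right (ν.mul_le y x) (norm_nonneg _)
    _ = ‖Φ‖ * ‖Ψ‖ := integral_mul_const _ _

noncomputable instance : NonUnitalNormedRing (CcSection 𝒞 μ ν) where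
  dist_eq := dist_eq_norm_neg_add
  norm_mul_le := norm_mul_le'

/-- A right invariant Haar measure (on a unimodular group) is inversion invariant. -/
theorem isInvInvariant [LocallyCompactSpace G] [μ.Regular] [μ.IsMulRightInvariant] :
    μ.IsInvInvariant := by
  constructor
  let c : ENNReal := μ.inv.haarScalarFactor μ
  have hc : μ.inv = c • μ := Measure.isMulLeftInvariant_eq_smul_of_regular μ.inv μ
  have h1 : μ.inv.inv = c ^ 2 • μ := by
    rw [Measure.inv, hc, Measure.map_smul, ← Measure.inv, hc, smul_smul, pow_two]
  rw [Measure.inv_inv] at h1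
  have K : TopologicalSpace.PositiveCompacts G := Classical.arbitrary _
  have h2 : c ^ 2 * μ K = 1 ^ 2 * μ K := by
    conv_rhs => rw [h1]
    simp
  have h3 : c ^ 2 = 1 ^ 2 :=
    (ENNReal.mul_left_inj (Measure.measure_pos_of_nonempty_interior _ K.interior_nonempty).ne'
      K.isCompact.measure_lt_top.ne).1 h2
  have h4 : c = 1 := (ENNReal.pow_right_strictMono two_ne_zero).injective h3
  rw [hc, h4, one_smul]

instance [LocallyCompactSpace G] [μ.Regular] [μ.IsMulRightInvariant] :
    NormedStarGroup (CcSection 𝒞 μ ν) where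
  norm_star_le Φ := by
    have := isInvInvariant (μ := μ)
    rw [norm_def, norm_def, ← integral_inv_eq_self (fun x => ν x * ‖Φ x‖) μ]
    refine le_of_eq (integral_congr_ae (Eventually.of_forall fun x => ?_))
    simp only [star_apply, 𝒞.norm_star, ν.inv]

end Algebra

end CcSection

/-- The Banach `*`-algebra `L^{1,ν}(G|𝒞)`: the completion of the continuous cross-sections with
compact support in the norm `∫ ν(x) ‖Φ(x)‖ dμ(x)`.  For `ν = 1` this is `L^1(G|𝒞)`. -/
def L1 {G : Type u} [Group G] [TopologicalSpace G] [IsTopologicalGroup G] [MeasurableSpace G]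
    [BorelSpace G] (𝒞 : FellBundle.{u, v} G) (μ : Measure G) [μ.IsHaarMeasure] (ν : Weight G) :
    Type (max u v) :=
  UniformSpace.Completion (CcSection 𝒞 μ ν)

namespace L1

open UniformSpace

variable {G : Type u} [Group G] [TopologicalSpace G] [IsTopologicalGroup G] [MeasurableSpace G]
  [BorelSpace G] {𝒞 : FellBundle.{u, v} G} {μ : Measure G} [μ.IsHaarMeasure] {ν : Weight G}

noncomputable instance : NormedAddCommGroup (L1 𝒞 μ ν) :=
  inferInstanceAs (NormedAddCommGroup (Completion (CcSection 𝒞 μ ν)))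

noncomputable instance : NormedSpace ℂ (L1 𝒞 μ ν) :=
  inferInstanceAs (NormedSpace ℂ (Completion (CcSection 𝒞 μ ν)))

instance : CompleteSpace (L1 𝒞 μ ν) :=
  inferInstanceAs (CompleteSpace (Completion (CcSection 𝒞 μ ν)))

/-- The canonical isometric embedding of the compactly supported continuous cross-sections. -/
noncomputable def ofCc : CcSection 𝒞 μ ν →ₗᵢ[ℂ] L1 𝒞 μ ν :=
  Completion.toComplₗᵢ

theorem isDenseInducing_ofCc : IsDenseInducing (ofCc : CcSection 𝒞 μ ν → L1 𝒞 μ ν) :=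
  Completion.isDenseInducing_coe

theorem denseRange_ofCc : DenseRange (ofCc : CcSection 𝒞 μ ν → L1 𝒞 μ ν) :=
  isDenseInducing_ofCc.dense

/-- The continuous extension of the convolution. -/
noncomputable instance : Mul (L1 𝒞 μ ν) where
  mul a b := (isDenseInducing_ofCc.prodMap isDenseInducing_ofCc).extend
    (fun p : CcSection 𝒞 μ ν × CcSection 𝒞 μ ν => (ofCc (p.1 * p.2) : L1 𝒞 μ ν)) (a, b)

/-- The continuous extension of the involution. -/
noncomputable instance [LocallyCompactSpace G] [μ.Regular] [μ.IsMulRightInvariant] :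
    Star (L1 𝒞 μ ν) where
  star := Completion.map (star : CcSection 𝒞 μ ν → CcSection 𝒞 μ ν)

theorem ofCc_mul (Φ Ψ : CcSection 𝒞 μ ν) :
    (ofCc (Φ * Ψ) : L1 𝒞 μ ν) = ofCc Φ * ofCc Ψ :=
  ((isDenseInducing_ofCc.prodMap isDenseInducing_ofCc).extend_eq
    (ofCc.continuous.comp continuous_mul) (Φ, Ψ)).symm

theorem ofCc_star [LocallyCompactSpace G] [μ.Regular] [μ.IsMulRightInvariant]
    (Φ : CcSection 𝒞 μ ν) : (ofCc (star Φ) : L1 𝒞 μ ν) = star (ofCc Φ) :=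
  (Completion.map_coe
    (starₗᵢ ℂ : CcSection 𝒞 μ ν ≃ₗᵢ⋆[ℂ] CcSection 𝒞 μ ν).isometry.uniformContinuous Φ).symm

instance : ContinuousMul (L1 𝒞 μ ν) where
  continuous_mul := by
    let m := (AddMonoidHom.mul : CcSection 𝒞 μ ν →+ CcSection 𝒞 μ ν →+ CcSection 𝒞 μ ν).compr₂
      (Completion.toCompl : CcSection 𝒞 μ ν →+ Completion (CcSection 𝒞 μ ν))
    have h : Continuous fun p : CcSection 𝒞 μ ν × CcSection 𝒞 μ ν => m p.1 p.2 :=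
      (Completion.continuous_coe _).comp continuous_mul
    have di : IsDenseInducing
        (Completion.toCompl : CcSection 𝒞 μ ν → Completion (CcSection 𝒞 μ ν)) :=
      Completion.isDenseInducing_coe
    exact (di.extend_Z_bilin di h :)

theorem continuous_star' [LocallyCompactSpace G] [μ.Regular] [μ.IsMulRightInvariant] :
    Continuous (star : L1 𝒞 μ ν → L1 𝒞 μ ν) :=
  Completion.continuous_map

@[elab_as_elim]
theorem induction_on {p : L1 𝒞 μ ν → Prop} (a : L1 𝒞 μ ν) (hp : IsClosed {a | p a})
    (ih : ∀ Φ, p (ofCc Φ)) : p a :=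
  Completion.induction_on a hp ih

@[elab_as_elim]
theorem induction_on₂ {p : L1 𝒞 μ ν → L1 𝒞 μ ν → Prop} (a b : L1 𝒞 μ ν)
    (hp : IsClosed {q : L1 𝒞 μ ν × L1 𝒞 μ ν | p q.1 q.2})
    (ih : ∀ Φ Ψ, p (ofCc Φ) (ofCc Ψ)) : p a b :=
  Completion.induction_on₂ a b hp ih

@[elab_as_elim]
theorem induction_on₃ {p : L1 𝒞 μ ν → L1 𝒞 μ ν → L1 𝒞 μ ν → Prop} (a b c : L1 𝒞 μ ν)
    (hp : IsClosed {q : L1 𝒞 μ ν × L1 𝒞 μ ν × L1 𝒞 μ ν | p q.1 q.2.1 q.2.2})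
    (ih : ∀ Φ Ψ Θ, p (ofCc Φ) (ofCc Ψ) (ofCc Θ)) : p a b c :=
  Completion.induction_on₃ a b c hp ih

noncomputable instance : NonUnitalRing (L1 𝒞 μ ν) where
  zero_mul a := induction_on a (isClosed_eq (by fun_prop) continuous_const) fun Φ => by
    rw [← map_zero ofCc, ← ofCc_mul, zero_mul]
  mul_zero a := induction_on a (isClosed_eq (by fun_prop) continuous_const) fun Φ => by
    rw [← map_zero ofCc, ← ofCc_mul, mul_zero]
  left_distrib a b c := induction_on₃ a b c (isClosed_eq (by fun_prop) (by fun_prop))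
    fun Φ Ψ Θ => by rw [← map_add, ← ofCc_mul, ← ofCc_mul, ← ofCc_mul, ← map_add, mul_add]
  right_distrib a b c := induction_on₃ a b c (isClosed_eq (by fun_prop) (by fun_prop))
    fun Φ Ψ Θ => by rw [← map_add, ← ofCc_mul, ← ofCc_mul, ← ofCc_mul, ← map_add, add_mul]
  mul_assoc a b c := induction_on₃ a b c (isClosed_eq (by fun_prop) (by fun_prop))
    fun Φ Ψ Θ => by rw [← ofCc_mul, ← ofCc_mul, ← ofCc_mul, ← ofCc_mul, mul_assoc]

noncomputable instance : NonUnitalNormedRing (L1 𝒞 μ ν) where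
  dist_eq := dist_eq_norm_neg_add
  norm_mul_le a b := induction_on₂ a b (isClosed_le (by fun_prop) (by fun_prop)) fun Φ Ψ => by
    rw [← ofCc_mul, ofCc.norm_map, ofCc.norm_map, ofCc.norm_map]
    exact norm_mul_le Φ Ψ

instance : IsScalarTower ℂ (L1 𝒞 μ ν) (L1 𝒞 μ ν) where
  smul_assoc r a b := induction_on₂ a b (isClosed_eq
      ((continuous_fst.const_smul r).mul continuous_snd)
      ((continuous_fst.mul continuous_snd).const_smul r)) fun Φ Ψ => by
    rw [smul_eq_mul, smul_eq_mul, ← map_smul, ← ofCc_mul, ← ofCc_mul, ← map_smul,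
      smul_mul_assoc]

instance : SMulCommClass ℂ (L1 𝒞 μ ν) (L1 𝒞 μ ν) where
  smul_comm r a b := induction_on₂ a b (isClosed_eq
      ((continuous_fst.mul continuous_snd).const_smul r)
      (continuous_fst.mul (continuous_snd.const_smul r))) fun Φ Ψ => by
    rw [smul_eq_mul, smul_eq_mul, ← map_smul, ← ofCc_mul, ← ofCc_mul, ← map_smul,
      mul_smul_comm]

section Star

variable [LocallyCompactSpace G] [μ.Regular] [μ.IsMulRightInvariant]

noncomputable instance : StarRing (L1 𝒞 μ ν) where
  star_involutive a := induction_on a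
    (isClosed_eq (continuous_star'.comp continuous_star') continuous_id) fun Φ => by
      rw [← ofCc_star, ← ofCc_star, star_star]
  star_add a b := induction_on₂ a b
    (isClosed_eq (continuous_star'.comp (continuous_fst.add continuous_snd))
      ((continuous_star'.comp continuous_fst).add (continuous_star'.comp continuous_snd)))
    fun Φ Ψ => by rw [← map_add, ← ofCc_star, ← ofCc_star, ← ofCc_star, ← map_add, star_add]
  star_mul a b := induction_on₂ a b
    (isClosed_eq (continuous_star'.comp (continuous_fst.mul continuous_snd))
      ((continuous_star'.comp continuous_snd).mul (continuous_star'.comp continuous_fst)))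
    fun Φ Ψ => by
      rw [← ofCc_mul, ← ofCc_star, ← ofCc_star, ← ofCc_star, ← ofCc_mul, star_mul]

instance : StarModule ℂ (L1 𝒞 μ ν) where
  star_smul r a := induction_on a
    (isClosed_eq (continuous_star'.comp (continuous_const_smul r))
      (continuous_star'.const_smul (star r))) fun Φ => by
      rw [← map_smul, ← ofCc_star, ← ofCc_star, ← map_smul, star_smul]

instance : NormedStarGroup (L1 𝒞 μ ν) where
  norm_star_le a := induction_on a
    (isClosed_le (continuous_norm.comp continuous_star') continuous_norm) fun Φ => by
      rw [← ofCc_star, ofCc.norm_map, ofCc.norm_map, norm_star]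

end Star

end L1

/-- A compactly supported continuous cross-section, regarded in the algebra with weight `1`. -/
def CcSection.toOne {G : Type u} [Group G] [TopologicalSpace G] [MeasurableSpace G]
    {𝒞 : FellBundle.{u, v} G} {μ : Measure G} {ν : Weight G} (Φ : CcSection 𝒞 μ ν) :
    CcSection 𝒞 μ (1 : Weight G) where
  toFun := Φ.toFun
  continuous_toFun := Φ.continuous_toFun
  hasCompactSupport_toFun := Φ.hasCompactSupport_toFun

namespace L1

open UniformSpace

variable {G : Type u} [Group G] [TopologicalSpace G] [IsTopologicalGroup G] [MeasurableSpace G]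
  [BorelSpace G] (𝒞 : FellBundle.{u, v} G) (μ : Measure G) [μ.IsHaarMeasure] (ν : Weight G)

/-- The identity of the compactly supported continuous cross-sections, as a map from the norm of
`L^{1,ν}` to the norm of `L^1`. -/
noncomputable def ccInclusion : CcSection 𝒞 μ ν →L[ℂ] CcSection 𝒞 μ (1 : Weight G) :=
  LinearMap.mkContinuous
    { toFun := CcSection.toOne
      map_add' := fun _ _ => rfl
      map_smul' := fun _ _ => rfl } 1 fun Φ => by
    rw [one_mul, CcSection.norm_def, CcSection.norm_def]
    refine integral_mono (CcSection.toOne Φ).integrable_norm Φ.integrable_norm fun x => ?_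
    simp only [Weight.one_apply]
    exact mul_le_mul_of_nonneg_right (ν.one_le x) (norm_nonneg _)

variable {𝒞 μ ν} in
/-- The inclusion on the completions. -/
noncomputable def inclusionFun : L1 𝒞 μ ν → L1 𝒞 μ (1 : Weight G) :=
  Completion.map (ccInclusion 𝒞 μ ν)

variable {𝒞 μ ν}

theorem continuous_inclusionFun : Continuous (inclusionFun : L1 𝒞 μ ν → L1 𝒞 μ 1) :=
  Completion.continuous_map

theorem inclusionFun_ofCc (Φ : CcSection 𝒞 μ ν) :
    inclusionFun (ofCc Φ : L1 𝒞 μ ν) = ofCc Φ.toOne :=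
  Completion.map_coe (ccInclusion 𝒞 μ ν).uniformContinuous Φ

variable (𝒞 μ ν)

/-- The canonical map `L^{1,ν}(G|𝒞) → L^1(G|𝒞)`, the continuous extension of the identity of the
compactly supported continuous cross-sections. -/
noncomputable def inclusion [LocallyCompactSpace G] [μ.Regular] [μ.IsMulRightInvariant] :
    L1 𝒞 μ ν →⋆ₙₐ[ℂ] L1 𝒞 μ (1 : Weight G) where
  toFun := inclusionFun
  map_smul' r a := induction_on a
    (isClosed_eq (continuous_inclusionFun.comp (continuous_const_smul r))
      (continuous_inclusionFun.const_smul r)) fun Φ => by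
      rw [← map_smul, inclusionFun_ofCc, inclusionFun_ofCc, MonoidHom.id_apply, ← map_smul]
      rfl
  map_zero' := by
    rw [← map_zero ofCc, inclusionFun_ofCc, ← map_zero ofCc]
    rfl
  map_add' a b := induction_on₂ a b
    (isClosed_eq (continuous_inclusionFun.comp (continuous_fst.add continuous_snd))
      ((continuous_inclusionFun.comp continuous_fst).add
        (continuous_inclusionFun.comp continuous_snd))) fun Φ Ψ => by
      rw [← map_add, inclusionFun_ofCc, inclusionFun_ofCc, inclusionFun_ofCc, ← map_add]
      rfl
  map_mul' a b := induction_on₂ a b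
    (isClosed_eq (continuous_inclusionFun.comp (continuous_fst.mul continuous_snd))
      ((continuous_inclusionFun.comp continuous_fst).mul
        (continuous_inclusionFun.comp continuous_snd))) fun Φ Ψ => by
      rw [← ofCc_mul, inclusionFun_ofCc, inclusionFun_ofCc, inclusionFun_ofCc, ← ofCc_mul]
      rfl
  map_star' a := induction_on a
    (isClosed_eq (continuous_inclusionFun.comp continuous_star')
      (continuous_star'.comp continuous_inclusionFun)) fun Φ => by
      rw [← ofCc_star, inclusionFun_ofCc, inclusionFun_ofCc, ← ofCc_star]
      rfl

end L1

/-- `e` is a two-sided identity element of the (possibly non-unital) ring `A`. -/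
def IsIdentityElement {A : Type*} [NonUnitalRing A] (e : A) : Prop :=
  ∀ a : A, e * a = a ∧ a * e = a

open scoped Classical in
/-- The spectrum `Spec_A(a)`: the set of all `z ∈ ℂ` such that `a - z 1` is not invertible in the
minimal unitization of `A`, which is `A` itself if `A` has an identity element and `A ⊕ ℂ`
otherwise. -/
noncomputable def minSpectrum {A : Type*} [NonUnitalRing A] [Module ℂ A] [IsScalarTower ℂ A A]
    [SMulCommClass ℂ A A] (a : A) : Set ℂ :=
  if ∃ e : A, IsIdentityElement e then
    {z | ∀ e : A, IsIdentityElement e → ¬ ∃ b : A, (a - z • e) * b = e ∧ b * (a - z • e) = e}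
  else
    spectrum ℂ (a : Unitization ℂ A)

/-- The homomorphism `ι : A → B` of Banach `*`-algebras is a continuous inclusion, and the image
of `A` is inverse-closed (spectrally invariant) in `B`. -/
def IsInverseClosedInclusion {A B : Type*} [NonUnitalNormedRing A] [StarRing A] [NormedSpace ℂ A]
    [IsScalarTower ℂ A A] [SMulCommClass ℂ A A] [NonUnitalNormedRing B] [StarRing B]
    [NormedSpace ℂ B] [IsScalarTower ℂ B B] [SMulCommClass ℂ B B] (ι : A →⋆ₙₐ[ℂ] B) : Prop :=
  Continuous ι ∧ Function.Injective ι ∧ ∀ a : A, minSpectrum a = minSpectrum (ι a)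

/-!
The theorem is an instance of a general fact on a dense inclusion `ι : A → B` of Banach
`*`-algebras whose norms satisfy the Leibniz type inequality
`‖a b‖_A ≤ C (‖a‖_A ‖b‖_B + ‖a‖_B ‖b‖_A)`.

For `A = L^{1,ν}` and `B = L^1` this inequality is what a polynomial weight provides: integrate
`ν (y x) ≤ C (ν y + ν x)` against `‖Φ y‖ ‖Ψ x‖` (`L1.norm_mul_le_of_polynomial`).  The inclusion is
injective because `ν` is bounded on the support of a compactly supported section
(`L1.inclusion_injective`).

Squaring repeatedly, the inequality gives `‖d ^ (2 ^ k)‖_A ≤ (2 C) ^ k ‖d‖_A ‖d‖_B ^ (2 ^ k - 1)`, so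
that the spectral radius of `d` in `A` is at most `‖d‖_B`; in the form used below, `1 - d` is
invertible in `A ⊕ ℂ` whenever `‖d‖_B < 1` (`isUnit_one_sub_inr`).  Both parts rest on this.

* If `x ∈ A ⊕ ℂ` has an inverse in `B ⊕ ℂ`, an approximation `y ∈ A ⊕ ℂ` of the inverse makes `x y`
  and `y x` of the form `1 - d` with `‖d‖_B < 1`, hence invertible over `A`
  (`isUnit_of_isUnit_starMap`).  To pass to minimal unitizations one has to know that `A` has an
  identity element if `B` has one.  Since the identity `e` of `B` is only approximated by elements
  of `A`, a quadratically convergent iteration which converges in both norms is used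
  (`IsIdentityElement.exists_map_eq`).
* If `φ` is a `*`-homomorphism from `A` to a `C*`-algebra, then `‖φ a‖ ^ 2 = ‖φ (a* a)‖` is the
  spectral radius of `φ (a* a)`, hence at most `‖a* a‖_B ≤ ‖a‖_B ^ 2` (`norm_map_le_norm`).  So `φ` is
  continuous for the norm of `B` and extends by density.
-/

/-! ### Comparison of spectral radii and inverse-closedness -/

/-- If `x * y` and `y' * x` are both invertible then so is `x`. -/
theorem isUnit_of_isUnit_mul_of_isUnit_mul {M : Type*} [Monoid M] {x y y' : M}
    (h : IsUnit (x * y)) (h' : IsUnit (y' * x)) : IsUnit x := by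
  obtain ⟨r, hr⟩ := h.exists_right_inv
  obtain ⟨l, hl⟩ := h'.exists_left_inv
  rw [mul_assoc] at hr
  rw [← mul_assoc] at hl
  have hlr : l * y' = y * r := left_inv_eq_right_inv hl hr
  exact ⟨⟨x, y * r, hr, by rw [← hlr, hl]⟩, rfl⟩

/-- An element whose iterated squares tend to zero is quasi-invertible. -/
theorem isUnit_one_sub_of_tendsto_sq {R : Type*} [NormedRing R] [CompleteSpace R] (d : R)
    (h : Tendsto (fun k => (fun x : R => x * x)^[k] d) atTop (𝓝 0)) : IsUnit (1 - d) := by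
  have hs : ∀ k, (fun x : R => x * x)^[k] d = d ^ 2 ^ k := by
    intro k
    induction k with
    | zero => simp
    | succ k ih => rw [Function.iterate_succ_apply', ih, ← pow_add, pow_succ, mul_two]
  obtain ⟨k, hk⟩ := ((tendsto_zero_iff_norm_tendsto_zero.1 h).eventually
    (gt_mem_nhds one_pos)).exists
  rw [hs] at hk
  have hu : IsUnit (1 - d ^ 2 ^ k) := (Units.oneSub _ hk).isUnit
  refine isUnit_of_isUnit_mul_of_isUnit_mul (y := ∑ i ∈ Finset.range (2 ^ k), d ^ i)
    (y' := ∑ i ∈ Finset.range (2 ^ k), d ^ i) ?_ ?_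
  · rwa [mul_neg_geom_sum]
  · rwa [geom_sum_mul_neg]

section Dense

variable {A B : Type*} [NonUnitalNormedRing A] [StarRing A] [NormedSpace ℂ A]
  [IsScalarTower ℂ A A] [SMulCommClass ℂ A A] [StarModule ℂ A] [CompleteSpace A]
  [NonUnitalNormedRing B] [StarRing B] [NormedSpace ℂ B] [IsScalarTower ℂ B B]
  [SMulCommClass ℂ B B] [StarModule ℂ B] {ι : A →⋆ₙₐ[ℂ] B} {C : ℝ}

/-- If the norm of `A` satisfies the Leibniz type inequality with respect to the norm of `B`, then
the iterated squares of an element of norm less than one in `B` tend to zero in `A`. -/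
theorem tendsto_iterate_sq (hC : ∀ a b : A, ‖a * b‖ ≤ C * (‖a‖ * ‖ι b‖ + ‖ι a‖ * ‖b‖))
    {d : A} (hd : ‖ι d‖ < 1) : Tendsto (fun k => (fun x : A => x * x)^[k] d) atTop (𝓝 0) := by
  set s : ℕ → A := fun k => (fun x : A => x * x)^[k] d with hs
  have hsucc : ∀ k, s (k + 1) = s k * s k := fun k => Function.iterate_succ_apply' _ _ _
  have hι : ∀ k, ‖ι (s k)‖ ≤ ‖ι d‖ ^ (k + 1) := by
    intro k
    induction k with
    | zero => simp [hs]
    | succ k ih =>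
      have h1 : ‖ι d‖ ^ (k + 1) ≤ ‖ι d‖ := pow_le_of_le_one (norm_nonneg _) hd.le (by simp)
      calc ‖ι (s (k + 1))‖ ≤ ‖ι (s k)‖ * ‖ι (s k)‖ := by
            rw [hsucc, map_mul]; exact norm_mul_le _ _
        _ ≤ ‖ι d‖ ^ (k + 1) * ‖ι d‖ := by
            gcongr
            exact ih.trans h1
        _ = ‖ι d‖ ^ (k + 1 + 1) := (pow_succ _ _).symm
  have hlim : Tendsto (fun k => 2 * C * ‖ι (s k)‖) atTop (𝓝 0) := by
    have h0 : Tendsto (fun k => ‖ι (s k)‖) atTop (𝓝 0) :=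
      squeeze_zero (fun _ => norm_nonneg _) hι
        ((tendsto_pow_atTop_nhds_zero_of_lt_one (norm_nonneg _) hd).comp (tendsto_add_atTop_nat 1))
    simpa using h0.const_mul (2 * C)
  have hsum : Summable s := by
    refine summable_of_ratio_norm_eventually_le (r := 1 / 2) (by norm_num) ?_
    filter_upwards [hlim.eventually (gt_mem_nhds (by norm_num : (0 : ℝ) < 1 / 2))] with k hk
    rw [hsucc]
    refine (hC _ _).trans ?_
    have := mul_le_mul_of_nonneg_right hk.le (norm_nonneg (s k))
    linarith
  exact hsum.tendsto_atTop_zero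

/-- The comparison of spectral radii: `d` is quasi-invertible in `A` as soon as its norm in `B` is
less than one. -/
theorem isUnit_one_sub_inr (hC : ∀ a b : A, ‖a * b‖ ≤ C * (‖a‖ * ‖ι b‖ + ‖ι a‖ * ‖b‖))
    {d : A} (hd : ‖ι d‖ < 1) : IsUnit (1 - (d : Unitization ℂ A)) := by
  let E := WithLp.unitizationAlgEquiv (𝕜 := ℂ) (A := A) ℂ
  let f : A → WithLp 1 (Unitization ℂ A) := fun x => WithLp.toLp 1 (x : Unitization ℂ A)
  have hf : ∀ k, (fun x => x * x)^[k] (f d) = f ((fun x => x * x)^[k] d) := fun k =>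
    (Function.Semiconj.iterate_right (f := f) (ga := fun x => x * x) (gb := fun x => x * x)
      (fun x => congrArg (WithLp.toLp 1) (Unitization.inr_mul ℂ x x)) k d).symm
  have h1 : IsUnit (1 - f d) := by
    refine isUnit_one_sub_of_tendsto_sq _ ?_
    simp only [hf]
    have := (WithLp.unitization_isometry_inr (𝕜 := ℂ) (A := A)).continuous.tendsto 0
    simp only [Unitization.inr_zero] at this
    exact this.comp (tendsto_iterate_sq hC hd)
  have h2 := h1.map E
  rwa [map_sub, map_one] at h2

theorem exists_norm_sub_map_lt (hι : DenseRange ι) (b : B) {K ε : ℝ} (hK : 0 ≤ K) (hε : 0 < ε) :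
    ∃ a : A, K * ‖b - ι a‖ < ε := by
  obtain ⟨a, ha⟩ := hι.exists_dist_lt b (show 0 < ε / (K + 1) by positivity)
  refine ⟨a, ?_⟩
  rw [dist_eq_norm, lt_div_iff₀ (by positivity)] at ha
  nlinarith [norm_nonneg (b - ι a)]

theorem starMap_eq_inl_add_inr (y : Unitization ℂ A) :
    Unitization.starMap ι y = Unitization.inl y.fst + (ι y.snd : Unitization ℂ B) := by
  conv_lhs => rw [← Unitization.inl_fst_add_inr_snd_eq y]
  rw [map_add, Unitization.starMap_inl, Unitization.starMap_inr]
  rfl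

theorem isUnit_of_starMap_eq_one_sub_inr
    (hC : ∀ a b : A, ‖a * b‖ ≤ C * (‖a‖ * ‖ι b‖ + ‖ι a‖ * ‖b‖)) {z : Unitization ℂ A} {s : B}
    (hs : ‖s‖ < 1) (hz : Unitization.starMap ι z = 1 - (s : Unitization ℂ B)) : IsUnit z := by
  rw [starMap_eq_inl_add_inr, sub_eq_add_neg] at hz
  have h1 : z.fst = 1 := by simpa using congrArg (fun w => w.fst) hz
  have h2 : ι (-z.snd) = s := by
    rw [map_neg, neg_eq_iff_eq_neg]
    simpa using congrArg (fun w => w.snd) hz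
  have h3 : z = 1 - ((-z.snd : A) : Unitization ℂ A) := by
    conv_lhs => rw [← Unitization.inl_fst_add_inr_snd_eq z, h1, Unitization.inl_one]
    rw [Unitization.inr_neg, sub_neg_eq_add]
  rw [h3]
  exact isUnit_one_sub_inr hC (by rwa [h2])

/-- A dense subalgebra that satisfies the Leibniz type inequality is inverse-closed in the sense of
unitizations: an element of `A ⊕ ℂ` which is invertible in `B ⊕ ℂ` has approximate inverses on both
sides, and these have invertible products with it by comparison of the spectral radii. -/
theorem isUnit_of_isUnit_starMap
    (hC : ∀ a b : A, ‖a * b‖ ≤ C * (‖a‖ * ‖ι b‖ + ‖ι a‖ * ‖b‖)) (hι : DenseRange ι)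
    {x : Unitization ℂ A} (hx : IsUnit (Unitization.starMap ι x)) : IsUnit x := by
  obtain ⟨⟨w, v, hv, hv'⟩, rfl : w = _⟩ := hx
  obtain ⟨c, hc⟩ := exists_norm_sub_map_lt hι v.snd
    (add_nonneg (norm_nonneg x.fst) (norm_nonneg (ι x.snd))) one_pos
  set t : B := v.snd - ι c
  set y : Unitization ℂ A := Unitization.inl v.fst + (c : Unitization ℂ A) with hy
  have hvc : v = Unitization.starMap ι y + t := by
    conv_lhs => rw [← Unitization.inl_fst_add_inr_snd_eq v]
    rw [hy, map_add, Unitization.starMap_inl, Unitization.starMap_inr, add_assoc,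
      ← Unitization.inr_add, add_sub_cancel]
    rfl
  rw [hvc] at hv hv'
  refine isUnit_of_isUnit_mul_of_isUnit_mul (y := y) (y' := y) ?_ ?_
  · refine isUnit_of_starMap_eq_one_sub_inr hC (s := x.fst • t + ι x.snd * t) ?_ ?_
    · calc _ ≤ ‖x.fst‖ * ‖t‖ + ‖ι x.snd‖ * ‖t‖ :=
            (norm_add_le _ _).trans (add_le_add (norm_smul_le _ _) (norm_mul_le _ _))
        _ < 1 := by rwa [← add_mul]
    · rw [map_mul, eq_sub_iff_add_eq, ← hv, mul_add]
      congr 1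
      rw [starMap_eq_inl_add_inr, add_mul, Unitization.inl_mul_inr, ← Unitization.inr_mul,
        ← Unitization.inr_add]
  · refine isUnit_of_starMap_eq_one_sub_inr hC (s := x.fst • t + t * ι x.snd) ?_ ?_
    · calc _ ≤ ‖x.fst‖ * ‖t‖ + ‖t‖ * ‖ι x.snd‖ :=
            (norm_add_le _ _).trans (add_le_add (norm_smul_le _ _) (norm_mul_le _ _))
        _ < 1 := by rwa [mul_comm ‖t‖, ← add_mul]
    · rw [map_mul, eq_sub_iff_add_eq, ← hv', add_mul]
      congr 1
      rw [starMap_eq_inl_add_inr, mul_add, Unitization.inr_mul_inl, ← Unitization.inr_mul,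
        ← Unitization.inr_add]

/-! ### Identity elements and the minimal unitization -/

theorem IsIdentityElement.eq {R : Type*} [NonUnitalRing R] {e f : R} (he : IsIdentityElement e)
    (hf : IsIdentityElement f) : e = f :=
  (hf e).2.symm.trans (he f).1

theorem IsIdentityElement.map (hι : DenseRange ι) {e : A}
    (he : IsIdentityElement e) : IsIdentityElement (ι e) := fun b =>
  hι.induction_on (p := fun b => ι e * b = b ∧ b * ι e = b) b
    ((isClosed_eq (by fun_prop) continuous_id).inter (isClosed_eq (by fun_prop) continuous_id))
    fun a => by simp only [← map_mul, he a, and_self]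

theorem exists_norm_sub_map_lt' (hι : DenseRange ι) (b : B) {ε : ℝ} (hε : 0 < ε) :
    ∃ a : A, ‖b - ι a‖ < ε := by
  simpa using exists_norm_sub_map_lt hι b zero_le_one hε

/-- If the completion in the weaker norm has an identity element `e`, then `e` already belongs to
the subalgebra.  Starting from an element `b` near `e`, the iteration `b ↦ 3 b ^ 2 - 2 b ^ 3`
converges to `e` in `B`.  Its increments are `(b - b ^ 2) (2 b - 1)`, and `b - b ^ 2` is replaced by
`x ^ 2 (3 + 4 x)` with `x = b - b ^ 2`, which by the Leibniz type inequality is a contraction in the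
norm of `A` as well. -/
theorem IsIdentityElement.exists_map_eq
    (hC : ∀ a b : A, ‖a * b‖ ≤ C * (‖a‖ * ‖ι b‖ + ‖ι a‖ * ‖b‖)) (hC0 : 0 < C)
    (hcont : Continuous ι) (hι : DenseRange ι) {e : B} (he : IsIdentityElement e) :
    ∃ s : A, ι s = e := by
  -- the constant of the contraction in the norm of `A`
  set K : ℝ := 10 * C + 8 * C ^ 2 with hK
  have hK0 : 0 < K := by positivity
  set θ : ℝ := min (1 / 10) (1 / (4 * K)) with hθ
  have hθ0 : 0 < θ := by positivity
  have hθ1 : θ ≤ 1 / 10 := min_le_left _ _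
  have hθK : K * (2 * θ) ≤ 1 / 2 := by
    have : θ ≤ 1 / (4 * K) := min_le_right _ _
    rw [le_div_iff₀ (by positivity)] at this
    linarith
  obtain ⟨b₀, hb₀⟩ := exists_norm_sub_map_lt' hι e hθ0
  let T : A → A := fun b => 3 • (b * b) - 2 • (b * b * b)
  set b : ℕ → A := fun n => T^[n] b₀ with hb
  have hsucc : ∀ n, b (n + 1) = 3 • (b n * b n) - 2 • (b n * b n * b n) := fun n =>
    Function.iterate_succ_apply' T n b₀
  set x : ℕ → A := fun n => b n - b n * b n with hx
  -- the iteration in `B`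
  have hu : ∀ n, e - ι (b (n + 1)) =
      3 • ((e - ι (b n)) * (e - ι (b n))) -
        2 • ((e - ι (b n)) * ((e - ι (b n)) * (e - ι (b n)))) := by
    intro n
    rw [hsucc]
    simp only [map_sub, map_mul, map_nsmul, mul_sub, sub_mul, (he _).1, (he _).2]
    rw [mul_assoc]
    abel
  have hunorm : ∀ n, ‖e - ι (b (n + 1))‖ ≤
      (3 + 2 * ‖e - ι (b n)‖) * ‖e - ι (b n)‖ * ‖e - ι (b n)‖ := by
    intro n
    set r := e - ι (b n)
    have h1 : ‖r * r‖ ≤ ‖r‖ * ‖r‖ := norm_mul_le _ _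
    have h2 : ‖r * (r * r)‖ ≤ ‖r‖ * (‖r‖ * ‖r‖) :=
      (norm_mul_le _ _).trans (mul_le_mul_of_nonneg_left h1 (norm_nonneg _))
    have h3 : ‖(3 : ℕ) • (r * r)‖ ≤ 3 * ‖r * r‖ := by simpa using norm_nsmul_le (n := 3) (a := r * r)
    have h4 : ‖(2 : ℕ) • (r * (r * r))‖ ≤ 2 * ‖r * (r * r)‖ := by
      simpa using norm_nsmul_le (n := 2) (a := r * (r * r))
    rw [hu]
    refine (norm_sub_le _ _).trans ?_
    linarith
  have hule : ∀ n, ‖e - ι (b n)‖ ≤ θ * (1 / 2) ^ n := by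
    intro n
    induction n with
    | zero => simpa [hb] using hb₀.le
    | succ n ih =>
      have h1 : ‖e - ι (b n)‖ ≤ 1 / 10 :=
        ih.trans ((mul_le_of_le_one_right hθ0.le (pow_le_one₀ (by norm_num) (by norm_num))).trans
          hθ1)
      have h2 := norm_nonneg (e - ι (b n))
      have h3 : (3 + 2 * ‖e - ι (b n)‖) * ‖e - ι (b n)‖ ≤ 1 / 2 := by nlinarith
      refine (hunorm n).trans ((mul_le_mul_of_nonneg_right h3 h2).trans ?_)
      rw [pow_succ]
      linarith
  have hlim : Tendsto (fun n => ι (b n)) atTop (𝓝 e) := by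
    rw [tendsto_iff_norm_sub_tendsto_zero]
    simp only [norm_sub_rev _ e]
    refine squeeze_zero (fun _ => norm_nonneg _) hule ?_
    simpa using (tendsto_pow_atTop_nhds_zero_of_lt_one (by norm_num : (0 : ℝ) ≤ 1 / 2)
      (by norm_num)).const_mul θ
  have hιx : ∀ n, ‖ι (x n)‖ ≤ 2 * θ := by
    intro n
    have h1 : ι (x n) = (e - ι (b n)) - (e - ι (b n)) * (e - ι (b n)) := by
      simp only [hx, map_sub, map_mul, mul_sub, sub_mul, (he _).1, (he _).2]
      abel
    have h2 : ‖e - ι (b n)‖ ≤ θ :=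
      (hule n).trans (mul_le_of_le_one_right hθ0.le (pow_le_one₀ (by norm_num) (by norm_num)))
    have h3 := norm_nonneg (e - ι (b n))
    rw [h1]
    refine (norm_sub_le _ _).trans ((add_le_add le_rfl (norm_mul_le _ _)).trans ?_)
    nlinarith
  -- the iteration in `A`
  have hxsucc : ∀ n, x (n + 1) = 3 • (x n * x n) + 4 • (x n * (x n * x n)) := by
    intro n
    simp only [hx, hsucc]
    noncomm_ring
  have hxnorm : ∀ n, ‖x (n + 1)‖ ≤ 1 / 2 * ‖x n‖ := by
    intro n
    have hξ := hιx n
    have hξ1 : ‖ι (x n)‖ ≤ 1 := by linarith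
    have hξ0 := norm_nonneg (ι (x n))
    have hn0 := norm_nonneg (x n)
    rw [hxsucc]
    set ξ := ‖ι (x n)‖
    have h1 : ‖x n * x n‖ ≤ 2 * C * (‖x n‖ * ξ) := (hC _ _).trans (le_of_eq (by ring))
    have h2 : ‖ι (x n * x n)‖ ≤ ξ * ξ := by rw [map_mul]; exact norm_mul_le _ _
    have h3 : ‖x n * (x n * x n)‖ ≤ (C + 2 * C ^ 2) * (‖x n‖ * ξ) := by
      calc _ ≤ C * (‖x n‖ * ‖ι (x n * x n)‖ + ξ * ‖x n * x n‖) := hC _ _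
        _ ≤ C * (‖x n‖ * (ξ * 1) + 1 * (2 * C * (‖x n‖ * ξ))) := by
            gcongr
            exact h2.trans (mul_le_mul_of_nonneg_left hξ1 hξ0)
        _ = _ := by ring
    have h4 : ‖(3 : ℕ) • (x n * x n)‖ ≤ 3 * ‖x n * x n‖ := by
      simpa using norm_nsmul_le (n := 3) (a := x n * x n)
    have h5 : ‖(4 : ℕ) • (x n * (x n * x n))‖ ≤ 4 * ‖x n * (x n * x n)‖ := by
      simpa using norm_nsmul_le (n := 4) (a := x n * (x n * x n))
    calc _ ≤ K * ξ * ‖x n‖ := by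
          refine (norm_add_le _ _).trans ?_
          rw [hK]
          linarith
      _ ≤ 1 / 2 * ‖x n‖ := by
          refine mul_le_mul_of_nonneg_right ?_ hn0
          exact (mul_le_mul_of_nonneg_left hξ hK0.le).trans hθK
  have hxlim : Tendsto (fun n => ‖x n‖) atTop (𝓝 0) :=
    tendsto_zero_iff_norm_tendsto_zero.1 (summable_of_ratio_norm_eventually_le
      (r := 1 / 2) (by norm_num) (Eventually.of_forall hxnorm)).tendsto_atTop_zero
  have hstep : ∀ n, ‖b (n + 1) - b n‖ ≤ 2 * (‖x n‖ * (‖b n‖ + 1)) := by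
    intro n
    have h1 : b (n + 1) - b n = 2 • (x n * b n) - x n := by
      simp only [hx, hsucc]
      noncomm_ring
    have h2 : ‖(2 : ℕ) • (x n * b n)‖ ≤ 2 * ‖x n * b n‖ := by
      simpa using norm_nsmul_le (n := 2) (a := x n * b n)
    rw [h1]
    refine (norm_sub_le _ _).trans ?_
    have := norm_mul_le (x n) (b n)
    linarith [norm_nonneg (x n)]
  have hsum : Summable fun n => ‖x n‖ * (‖b n‖ + 1) := by
    refine summable_of_ratio_norm_eventually_le (r := 3 / 4) (by norm_num) ?_
    filter_upwards [hxlim.eventually (gt_mem_nhds (by norm_num : (0 : ℝ) < 1 / 4))] with n hn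
    rw [Real.norm_of_nonneg (by positivity), Real.norm_of_nonneg (by positivity)]
    have h1 : ‖b (n + 1)‖ + 1 ≤ 3 / 2 * (‖b n‖ + 1) := by
      have h2 : ‖b (n + 1)‖ ≤ ‖b n‖ + ‖b (n + 1) - b n‖ := norm_le_norm_add_norm_sub' _ _
      have h3 := hstep n
      have h4 := norm_nonneg (b n)
      nlinarith
    calc _ ≤ 1 / 2 * ‖x n‖ * (3 / 2 * (‖b n‖ + 1)) := by
          gcongr
          exact hxnorm n
      _ = _ := by ring
  have hcauchy : CauchySeq b := by
    refine cauchySeq_of_summable_dist (Summable.of_nonneg_of_le (fun _ => dist_nonneg) ?_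
      (hsum.mul_left 2))
    intro n
    rw [dist_comm, dist_eq_norm]
    exact hstep n
  obtain ⟨s, hs⟩ := cauchySeq_tendsto_of_complete hcauchy
  exact ⟨s, tendsto_nhds_unique ((hcont.tendsto s).comp hs) hlim⟩

theorem exists_isIdentityElement_iff
    (hC : ∀ a b : A, ‖a * b‖ ≤ C * (‖a‖ * ‖ι b‖ + ‖ι a‖ * ‖b‖)) (hC0 : 0 < C)
    (hcont : Continuous ι) (hι : DenseRange ι) (hinj : Function.Injective ι) :
    (∃ e : A, IsIdentityElement e) ↔ ∃ e : B, IsIdentityElement e := by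
  constructor
  · rintro ⟨e, he⟩
    exact ⟨ι e, he.map hι⟩
  · rintro ⟨e, he⟩
    obtain ⟨s, rfl⟩ := he.exists_map_eq hC hC0 hcont hι
    exact ⟨s, fun a => ⟨hinj (by rw [map_mul, (he _).1]), hinj (by rw [map_mul, (he _).2])⟩⟩

/-- In a ring with identity element `e`, the element `x` is invertible if and only if
`x + (1 - e)` is invertible in the (non-minimal) unitization. -/
theorem IsIdentityElement.isUnit_unitization_iff {R : Type*} [NonUnitalRing R] [Module ℂ R]
    [IsScalarTower ℂ R R] [SMulCommClass ℂ R R] {e : R} (he : IsIdentityElement e) (x : R) :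
    IsUnit (1 + ((x - e : R) : Unitization ℂ R)) ↔ ∃ b, x * b = e ∧ b * x = e := by
  have key : ∀ a b : R, (1 + ((a - e : R) : Unitization ℂ R)) * (1 + ((b - e : R) : Unitization ℂ R))
      = 1 + ((a * b - e : R) : Unitization ℂ R) := by
    intro a b
    rw [mul_add, add_mul, add_mul, one_mul, one_mul, mul_one, ← Unitization.inr_mul, add_assoc,
      ← Unitization.inr_add, ← Unitization.inr_add]
    congr 2
    simp only [mul_sub, sub_mul, (he _).1, (he _).2]
    abel
  constructor
  · rintro ⟨⟨w, v, hv, hv'⟩, rfl : w = _⟩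
    have h1 : v.fst = 1 := by
      generalize x - e = y at hv
      simpa using congrArg (fun w => w.fst) hv
    obtain ⟨b, hb⟩ : ∃ b, v = 1 + ((b - e : R) : Unitization ℂ R) := by
      refine ⟨v.snd + e, ?_⟩
      conv_lhs => rw [← Unitization.inl_fst_add_inr_snd_eq v, h1, Unitization.inl_one]
      rw [add_sub_cancel_right]
    rw [hb, key, add_eq_left, ← Unitization.inr_zero, Unitization.inr_injective.eq_iff,
      sub_eq_zero] at hv hv'
    exact ⟨b, hv, hv'⟩
  · rintro ⟨b, hb, hb'⟩
    refine ⟨⟨_, 1 + ((b - e : R) : Unitization ℂ R), ?_, ?_⟩, rfl⟩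
    · rw [key, hb, sub_self, Unitization.inr_zero, add_zero]
    · rw [key, hb', sub_self, Unitization.inr_zero, add_zero]

theorem IsIdentityElement.minSpectrum_eq {R : Type*} [NonUnitalRing R] [Module ℂ R]
    [IsScalarTower ℂ R R] [SMulCommClass ℂ R R] {e : R} (he : IsIdentityElement e) (a : R) :
    minSpectrum a = {z | ¬ IsUnit (1 + ((a - z • e - e : R) : Unitization ℂ R))} := by
  rw [minSpectrum, if_pos ⟨e, he⟩]
  ext z
  rw [Set.mem_ofPred_eq, Set.mem_ofPred_eq, he.isUnit_unitization_iff]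
  refine ⟨fun h => h e he, fun h f hf => ?_⟩
  rwa [hf.eq he]

/-- A dense subalgebra that satisfies the Leibniz type inequality is spectrally invariant. -/
theorem minSpectrum_map (hC : ∀ a b : A, ‖a * b‖ ≤ C * (‖a‖ * ‖ι b‖ + ‖ι a‖ * ‖b‖)) (hC0 : 0 < C)
    (hcont : Continuous ι) (hι : DenseRange ι) (hinj : Function.Injective ι) (a : A) :
    minSpectrum a = minSpectrum (ι a) := by
  have hunit : ∀ x : Unitization ℂ A, IsUnit x ↔ IsUnit (Unitization.starMap ι x) := fun x =>
    ⟨fun h => h.map _, isUnit_of_isUnit_starMap hC hι⟩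
  have hiff := exists_isIdentityElement_iff hC hC0 hcont hι hinj
  by_cases h : ∃ e : A, IsIdentityElement e
  · obtain ⟨e, he⟩ := h
    rw [he.minSpectrum_eq, (he.map hι).minSpectrum_eq]
    ext z
    rw [Set.mem_ofPred_eq, Set.mem_ofPred_eq, hunit, map_add, map_one, Unitization.starMap_inr,
      map_sub, map_sub, map_smul]
  · rw [minSpectrum, if_neg h, minSpectrum, if_neg (hiff.not.1 h)]
    ext z
    rw [spectrum.mem_iff, spectrum.mem_iff, hunit, map_sub, AlgHomClass.commutes,
      Unitization.starMap_inr]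

/-! ### Automatic continuity of homomorphisms into `C*`-algebras -/

/-- A `*`-homomorphism into a `C*`-algebra is contractive for the norm of `B`: for self-adjoint `d`
the norm of `φ d` is the modulus of a spectral value of `φ d`, which is at most `‖ι d‖` by the
comparison of spectral radii. -/
theorem norm_map_le_norm_of_isSelfAdjoint {D : Type*} [NonUnitalCStarAlgebra D]
    (hC : ∀ a b : A, ‖a * b‖ ≤ C * (‖a‖ * ‖ι b‖ + ‖ι a‖ * ‖b‖)) (φ : A →⋆ₙₐ[ℂ] D) {d : A}
    (hd : IsSelfAdjoint d) : ‖φ d‖ ≤ ‖ι d‖ := by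
  by_contra! hlt
  have hsa : IsSelfAdjoint ((φ d : D) : Unitization ℂ D) := (hd.map φ).inr ℂ
  obtain ⟨z, hz, hzn⟩ := spectrum.exists_nnnorm_eq_spectralRadius ((φ d : D) : Unitization ℂ D)
  rw [hsa.spectralRadius_eq_nnnorm, ENNReal.coe_inj, Unitization.nnnorm_inr] at hzn
  have hzn' : ‖z‖ = ‖φ d‖ := congrArg NNReal.toReal hzn
  have hz0' : 0 < ‖z‖ := hzn' ▸ (norm_nonneg _).trans_lt hlt
  have hz0 : z ≠ 0 := norm_pos_iff.1 hz0'
  refine (spectrum.mem_iff.1 hz) ?_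
  have hsmall : ‖ι (z⁻¹ • d)‖ < 1 := by
    rw [map_smul, norm_smul, norm_inv, inv_mul_lt_iff₀ hz0', mul_one, hzn']
    exact hlt
  have h1 := (isUnit_one_sub_inr hC hsmall).map (Unitization.starMap φ)
  rw [map_sub, map_one, Unitization.starMap_inr, map_smul] at h1
  have h2 := ((IsUnit.mk0 z hz0).map (algebraMap ℂ (Unitization ℂ D))).mul h1
  rwa [mul_sub, mul_one, ← Algebra.smul_def, ← Unitization.inr_smul, smul_inv_smul₀ hz0] at h2

theorem norm_map_le_norm [NormedStarGroup B] {D : Type*} [NonUnitalCStarAlgebra D]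
    (hC : ∀ a b : A, ‖a * b‖ ≤ C * (‖a‖ * ‖ι b‖ + ‖ι a‖ * ‖b‖)) (φ : A →⋆ₙₐ[ℂ] D) (a : A) :
    ‖φ a‖ ≤ ‖ι a‖ := by
  have h1 := norm_map_le_norm_of_isSelfAdjoint hC φ (IsSelfAdjoint.star_mul_self a)
  rw [map_mul, map_star, CStarRing.norm_star_mul_self, map_mul, map_star] at h1
  have h2 := h1.trans (norm_mul_le _ _)
  rw [norm_star] at h2
  exact abs_le_of_sq_le_sq' (by rwa [pow_two, pow_two]) (norm_nonneg _) |>.2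

theorem exists_starAlgHom_extension [NormedStarGroup B] {D : Type*} [NonUnitalCStarAlgebra D]
    (hC : ∀ a b : A, ‖a * b‖ ≤ C * (‖a‖ * ‖ι b‖ + ‖ι a‖ * ‖b‖)) (hι : DenseRange ι)
    (φ : A →⋆ₙₐ[ℂ] D) : ∃ ψ : B →⋆ₙₐ[ℂ] D, ∀ a, ψ (ι a) = φ a := by
  let f : A →ₗ[ℂ] D := { toFun := φ, map_add' := map_add φ, map_smul' := map_smul φ }
  let i : A →ₗ[ℂ] B := { toFun := ι, map_add' := map_add ι, map_smul' := map_smul ι }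
  let F : B →L[ℂ] D := f.extendOfNorm i
  have hF : ∀ a, F (ι a) = φ a := fun a =>
    LinearMap.extendOfNorm_eq (f := f) (e := i) hι
      ⟨1, fun x => by rw [one_mul]; exact norm_map_le_norm hC φ x⟩ a
  refine ⟨{ toFun := F, map_smul' := map_smul F, map_zero' := map_zero F, map_add' := map_add F,
            map_mul' := fun b c => ?_, map_star' := fun b => ?_ }, hF⟩
  · refine hι.induction_on₂ (p := fun b c => F (b * c) = F b * F c)
      (isClosed_eq (by fun_prop) (by fun_prop)) (fun a a' => ?_) b c
    rw [← map_mul, hF, hF, hF, map_mul]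
  · refine hι.induction_on (p := fun b => F (star b) = star (F b)) b
      (isClosed_eq (by fun_prop) (by fun_prop)) fun a => ?_
    rw [← map_star, hF, hF, map_star]

end Dense

section Convolution

variable {G : Type u} [Group G] [TopologicalSpace G] [IsTopologicalGroup G] [MeasurableSpace G]
  [BorelSpace G] {𝒞 : FellBundle.{u, v} G} {μ : Measure G} [μ.IsHaarMeasure] {ν : Weight G}

namespace CcSection

/-! ### The Leibniz type inequality for a polynomial weight -/

open scoped Pointwise in
theorem norm_mul_le_integral (Φ Ψ : CcSection 𝒞 μ ν) :
    ‖Φ * Ψ‖ ≤ ∫ y, ‖Φ y‖ * ∫ x, ν (y * x) * ‖Ψ x‖ ∂μ ∂μ := by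
  let f : G → G → ℝ := fun x y => ‖Φ y‖ * ‖Ψ (y⁻¹ * x)‖
  have hfc : Continuous f.uncurry :=
    (Φ.continuous_norm.comp continuous_snd).mul
      (Ψ.continuous_norm.comp (by fun_prop : Continuous fun p : G × G => p.2⁻¹ * p.1))
  have hf0 : ∀ x y, (y ∉ tsupport fun y => ‖Φ y‖) → f x y = 0 := fun x y hy => by
    simp [f, Φ.apply_eq_zero hy]
  have hf1 : ∀ x y, x ∉ (tsupport fun y => ‖Φ y‖) * (tsupport fun y => ‖Ψ y‖) → f x y = 0 := by
    intro x y hx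
    by_cases hy : y ∈ tsupport fun y => ‖Φ y‖
    · have h2 : y⁻¹ * x ∉ tsupport fun y => ‖Ψ y‖ := fun h =>
        hx (Set.mem_mul.2 ⟨y, hy, _, h, mul_inv_cancel_left y x⟩)
      simp [f, Ψ.apply_eq_zero h2]
    · exact hf0 x y hy
  have hK := Φ.hasCompactSupport_toFun.isCompact.mul Ψ.hasCompactSupport_toFun.isCompact
  have hfs : HasCompactSupport f.uncurry := by
    refine HasCompactSupport.intro (hK.prod Φ.hasCompactSupport_toFun.isCompact) ?_
    rintro ⟨x, y⟩ hxy
    by_cases hy : y ∈ tsupport fun y => ‖Φ y‖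
    · exact hf1 x y fun hx => hxy ⟨hx, hy⟩
    · exact hf0 x y hy
  have hfi : ∀ x, Integrable (f x) μ := fun x =>
    (hfc.comp (Continuous.prodMk_right x)).integrable_of_hasCompactSupport
      (HasCompactSupport.intro Φ.hasCompactSupport_toFun.isCompact fun y hy => hf0 x y hy)
  have hFc : Continuous fun x => ∫ y, f x y ∂μ := by
    rw [← continuousOn_univ]
    exact continuousOn_integral_of_compact_support Φ.hasCompactSupport_toFun.isCompact
      hfc.continuousOn fun x y _ hy => hf0 x y hy
  have hFs : HasCompactSupport fun x => ∫ y, f x y ∂μ :=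
    HasCompactSupport.intro hK
      fun x hx => integral_eq_zero_of_ae (Eventually.of_forall fun y => hf1 x y hx)
  -- the measure `ν(x) dx`, which turns the double integral into one of a continuous function
  let μ' : Measure G := μ.withDensity fun x => ENNReal.ofReal (ν x)
  have hμ' : ∀ g : G → ℝ, ∫ x, g x ∂μ' = ∫ x, ν x * g x ∂μ := fun g => by
    rw [integral_withDensity_eq_integral_toReal_smul ν.measurable.ennreal_ofReal
      (Eventually.of_forall fun x => ENNReal.ofReal_lt_top)]
    refine integral_congr_ae (Eventually.of_forall fun x => ?_)
    simp [ENNReal.toReal_ofReal (ν.nonneg x)]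
  have : IsFiniteMeasureOnCompacts μ' := by
    refine ⟨fun K hK => ?_⟩
    obtain ⟨M, hM⟩ := ν.exists_bound hK.closure
    refine (measure_mono subset_closure).trans_lt ?_
    rw [withDensity_apply _ isClosed_closure.measurableSet]
    refine (setLIntegral_mono measurable_const fun x hx =>
      ENNReal.ofReal_le_ofReal (hM x hx)).trans_lt ?_
    rw [setLIntegral_const]
    exact ENNReal.mul_lt_top ENNReal.ofReal_lt_top hK.closure.measure_lt_top
  calc ‖Φ * Ψ‖ ≤ ∫ x, ν x * ∫ y, f x y ∂μ ∂μ := by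
        refine integral_mono (Φ * Ψ).integrable_norm (ν.integrable_mul μ hFc hFs) fun x => ?_
        refine mul_le_mul_of_nonneg_left ?_ (ν.nonneg x)
        rw [mul_apply]
        exact norm_integral_le_of_norm_le (hfi x)
          (Eventually.of_forall fun y => 𝒞.norm_mul_le _ _ _)
    _ = ∫ x, ∫ y, f x y ∂μ ∂μ' := (hμ' _).symm
    _ = ∫ y, ∫ x, f x y ∂μ' ∂μ := integral_integral_swap_of_hasCompactSupport hfc hfs
    _ = ∫ y, ‖Φ y‖ * ∫ x, ν (y * x) * ‖Ψ x‖ ∂μ ∂μ := by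
        refine integral_congr_ae (Eventually.of_forall fun y => ?_)
        simp only [hμ', f]
        rw [← integral_mul_left_eq_self (μ := μ) (fun x => ν x * (‖Φ y‖ * ‖Ψ (y⁻¹ * x)‖)) y,
          ← integral_const_mul]
        refine integral_congr_ae (Eventually.of_forall fun x => ?_)
        have hx : ∀ z, z = x → ‖Ψ z‖ = ‖Ψ x‖ := by
          rintro z rfl
          rfl
        simp only [hx _ (inv_mul_cancel_left y x)]
        ring

theorem norm_toOne (Φ : CcSection 𝒞 μ ν) : ‖Φ.toOne‖ = ∫ x, ‖Φ x‖ ∂μ := by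
  simp only [norm_def, Weight.one_apply, one_mul]
  rfl

theorem integrable_norm_apply (Φ : CcSection 𝒞 μ ν) : Integrable (fun x => ‖Φ x‖) μ :=
  Φ.continuous_norm.integrable_of_hasCompactSupport Φ.hasCompactSupport_toFun

/-- For a polynomial weight, `‖Φ * Ψ‖` is controlled by products of one weighted and one unweighted
norm: integrate `ν (y x) ≤ C (ν y + ν x)` against `‖Φ y‖ ‖Ψ x‖`. -/
theorem norm_mul_le_of_polynomial {C : ℝ} (hC : ∀ x y, ν (x * y) ≤ C * (ν x + ν y))
    (Φ Ψ : CcSection 𝒞 μ ν) :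
    ‖Φ * Ψ‖ ≤ C * (‖Φ‖ * ‖Ψ.toOne‖ + ‖Φ.toOne‖ * ‖Ψ‖) := by
  have hinner : ∀ y, ∫ x, ν (y * x) * ‖Ψ x‖ ∂μ ≤ C * (ν y * ‖Ψ.toOne‖ + ‖Ψ‖) := by
    intro y
    calc ∫ x, ν (y * x) * ‖Ψ x‖ ∂μ ≤ ∫ x, C * (ν y * ‖Ψ x‖ + ν x * ‖Ψ x‖) ∂μ := by
          refine integral_mono_of_nonneg (Eventually.of_forall fun x =>
            mul_nonneg (ν.nonneg _) (norm_nonneg _))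
            (((Ψ.integrable_norm_apply.const_mul _).add Ψ.integrable_norm).const_mul _)
            (Eventually.of_forall fun x => ?_)
          simp only
          rw [← add_mul, ← mul_assoc]
          exact mul_le_mul_of_nonneg_right (hC y x) (norm_nonneg _)
      _ = _ := by
          rw [integral_const_mul, integral_add (Ψ.integrable_norm_apply.const_mul _)
            Ψ.integrable_norm, integral_const_mul, norm_toOne, norm_def]
  refine (norm_mul_le_integral Φ Ψ).trans ?_
  calc ∫ y, ‖Φ y‖ * ∫ x, ν (y * x) * ‖Ψ x‖ ∂μ ∂μ
      ≤ ∫ y, C * (ν y * ‖Φ y‖ * ‖Ψ.toOne‖ + ‖Φ y‖ * ‖Ψ‖) ∂μ := by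
        refine integral_mono_of_nonneg (Eventually.of_forall fun y =>
          mul_nonneg (norm_nonneg _)
            (integral_nonneg fun x => mul_nonneg (ν.nonneg _) (norm_nonneg _)))
          (((Φ.integrable_norm.mul_const _).add (Φ.integrable_norm_apply.mul_const _)).const_mul _)
          (Eventually.of_forall fun y => ?_)
        refine (mul_le_mul_of_nonneg_left (hinner y) (norm_nonneg _)).trans (le_of_eq ?_)
        simp only
        ring
    _ = _ := by
        rw [integral_const_mul, integral_add (Φ.integrable_norm.mul_const _)
          (Φ.integrable_norm_apply.mul_const _), integral_mul_const, integral_mul_const,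
          ← norm_def, ← norm_toOne]

/-- The weighted norm of a section with support in `{ν ≤ M}` is dominated by the weighted distance
to any other section and the unweighted norm of the latter. -/
theorem norm_le_norm_sub_add {M : ℝ} (Φ Ψ : CcSection 𝒞 μ ν) (hM0 : 0 ≤ M)
    (hM : ∀ x ∈ tsupport fun y => ‖Φ y‖, ν x ≤ M) : ‖Φ‖ ≤ ‖Φ - Ψ‖ + M * ‖Ψ.toOne‖ := by
  rw [norm_toOne, norm_def, norm_def, ← integral_const_mul,
    ← integral_add (Φ - Ψ).integrable_norm (Ψ.integrable_norm_apply.const_mul M)]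
  refine integral_mono Φ.integrable_norm
    ((Φ - Ψ).integrable_norm.add (Ψ.integrable_norm_apply.const_mul M)) fun x => ?_
  simp only [sub_apply]
  have h0 := ν.nonneg x
  have h1 := norm_nonneg (Ψ x)
  by_cases hx : x ∈ tsupport fun y => ‖Φ y‖
  · have h2 : ‖Φ x‖ ≤ ‖Φ x - Ψ x‖ + ‖Ψ x‖ := by simpa using norm_add_le (Φ x - Ψ x) (Ψ x)
    calc ν x * ‖Φ x‖ ≤ ν x * ‖Φ x - Ψ x‖ + ν x * ‖Ψ x‖ := by
          rw [← mul_add]; exact mul_le_mul_of_nonneg_left h2 h0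
      _ ≤ _ := by
          gcongr
          exact hM x hx
  · rw [Φ.apply_eq_zero hx, norm_zero, mul_zero]
    positivity

theorem toOne_surjective :
    Function.Surjective (toOne : CcSection 𝒞 μ ν → CcSection 𝒞 μ (1 : Weight G)) := fun Φ =>
  ⟨⟨Φ.toFun, Φ.continuous_toFun, Φ.hasCompactSupport_toFun⟩, rfl⟩

end CcSection

namespace L1

/-! ### The inclusion of the weighted algebra -/

variable [LocallyCompactSpace G] [μ.Regular] [μ.IsMulRightInvariant]

theorem inclusion_ofCc (Φ : CcSection 𝒞 μ ν) :
    inclusion 𝒞 μ ν (ofCc Φ) = ofCc Φ.toOne :=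
  inclusionFun_ofCc Φ

theorem continuous_inclusion : Continuous (inclusion 𝒞 μ ν) :=
  continuous_inclusionFun

theorem norm_inclusion_le (a : L1 𝒞 μ ν) : ‖inclusion 𝒞 μ ν a‖ ≤ ‖a‖ := by
  refine induction_on a (isClosed_le continuous_inclusion.norm continuous_norm) fun Φ => ?_
  rw [inclusion_ofCc, ofCc.norm_map, ofCc.norm_map]
  exact ((ccInclusion 𝒞 μ ν).le_of_opNorm_le (LinearMap.mkContinuous_norm_le _ zero_le_one _)
    Φ).trans_eq (one_mul _)

theorem denseRange_inclusion : DenseRange (inclusion 𝒞 μ ν) := by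
  refine denseRange_ofCc.mono ?_
  rintro _ ⟨Φ, rfl⟩
  obtain ⟨Ψ, rfl⟩ := CcSection.toOne_surjective (ν := ν) Φ
  exact ⟨ofCc Ψ, inclusion_ofCc Ψ⟩

/-- If `a` vanishes in `L^1`, approximate it first by a section `Φ`, on whose support `ν` is bounded
by some `M`, then by a section `Ψ` whose unweighted norm is small compared with `1 / M`. -/
theorem inclusion_injective : Function.Injective (inclusion 𝒞 μ ν) := by
  rw [injective_iff_map_eq_zero]
  intro a ha
  have happrox : ∀ ε > 0, ∃ Φ : CcSection 𝒞 μ ν, ‖a - ofCc Φ‖ < ε := fun ε hε => by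
    obtain ⟨Φ, hΦ⟩ := denseRange_ofCc.exists_dist_lt a hε
    exact ⟨Φ, by rwa [← dist_eq_norm]⟩
  rw [← norm_le_zero_iff]
  refine le_of_forall_pos_le_add fun ε hε => ?_
  rw [zero_add]
  obtain ⟨Φ, hΦ⟩ := happrox (ε / 4) (by positivity)
  obtain ⟨M, hM⟩ := ν.exists_bound Φ.hasCompactSupport_toFun
  have hM' : ∀ x ∈ tsupport fun y => ‖Φ y‖, ν x ≤ |M| := fun x hx => (hM x hx).trans (le_abs_self M)
  obtain ⟨Ψ, hΨ⟩ := happrox (ε / 4 / (|M| + 1)) (by positivity)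
  have h1 : ‖Ψ.toOne‖ ≤ ‖a - ofCc Ψ‖ := by
    have h := norm_inclusion_le (a - ofCc Ψ)
    rwa [map_sub, ha, zero_sub, norm_neg, inclusion_ofCc, ofCc.norm_map] at h
  have h2 : (|M| + 1) * ‖a - ofCc Ψ‖ ≤ ε / 4 := by
    rw [lt_div_iff₀ (by positivity)] at hΨ
    linarith
  have h3 : ‖Φ - Ψ‖ ≤ ‖a - ofCc Φ‖ + ‖a - ofCc Ψ‖ := by
    rw [← (ofCc : CcSection 𝒞 μ ν →ₗᵢ[ℂ] L1 𝒞 μ ν).norm_map, map_sub, norm_sub_rev a (ofCc Φ)]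
    exact norm_sub_le_norm_sub_add_norm_sub _ _ _
  have h4 := CcSection.norm_le_norm_sub_add Φ Ψ (abs_nonneg M) hM'
  have h5 : ‖a‖ ≤ ‖a - ofCc Φ‖ + ‖Φ‖ := by
    rw [← (ofCc : CcSection 𝒞 μ ν →ₗᵢ[ℂ] L1 𝒞 μ ν).norm_map]
    simpa using norm_add_le (a - ofCc Φ) (ofCc Φ)
  have h6 := mul_le_mul_of_nonneg_left h1 (abs_nonneg M)
  linarith

theorem norm_mul_le_of_polynomial {C : ℝ} (hC : ∀ x y, ν (x * y) ≤ C * (ν x + ν y))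
    (a b : L1 𝒞 μ ν) :
    ‖a * b‖ ≤ C * (‖a‖ * ‖inclusion 𝒞 μ ν b‖ + ‖inclusion 𝒞 μ ν a‖ * ‖b‖) := by
  have hi := continuous_inclusion (𝒞 := 𝒞) (μ := μ) (ν := ν)
  refine induction_on₂ a b (isClosed_le (by fun_prop) (by fun_prop)) fun Φ Ψ => ?_
  rw [← ofCc_mul, inclusion_ofCc, inclusion_ofCc, ofCc.norm_map, ofCc.norm_map, ofCc.norm_map,
    ofCc.norm_map, ofCc.norm_map]
  exact CcSection.norm_mul_le_of_polynomial hC Φ Ψ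

end L1

end Convolution

theorem mainTheorem10 {G : Type u} [Group G] [TopologicalSpace G] [IsTopologicalGroup G]
    [LocallyCompactSpace G] [T2Space G] [MeasurableSpace G] [BorelSpace G]
    (μ : Measure G) [μ.IsHaarMeasure] [μ.Regular] [μ.IsMulRightInvariant]
    (𝒞 : FellBundle.{u, v} G) (ν : Weight G) (hν : ν.IsPolynomial) :
    IsInverseClosedInclusion (L1.inclusion 𝒞 μ ν) ∧
      ∀ (B : Type w) [NonUnitalCStarAlgebra B] (φ : L1 𝒞 μ ν →⋆ₙₐ[ℂ] B),
        ∃ ψ : L1 𝒞 μ (1 : Weight G) →⋆ₙₐ[ℂ] B,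
          ∀ a : L1 𝒞 μ ν, ψ (L1.inclusion 𝒞 μ ν a) = φ a := by
  obtain ⟨C, hC0, hC⟩ := hν
  have hmul := L1.norm_mul_le_of_polynomial (𝒞 := 𝒞) (μ := μ) hC
  exact ⟨⟨L1.continuous_inclusion, L1.inclusion_injective,
    minSpectrum_map hmul hC0 L1.continuous_inclusion L1.denseRange_inclusion
      L1.inclusion_injective⟩,
    fun B _ φ => exists_starAlgHom_extension hmul L1.denseRange_inclusion φ⟩
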